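/- **Setting.** Let $f:\mathbb R^{m_1}\times\dots\times\mathbb R^{m_n}\to\mathbb R$ be differentiable and, for $i=1,\dots,n$, let $h_i:\mathbb R^{m_i}\to\mathbb R^{p_i}$ have convex differentiable components. Put $S_i=\{w: h_i(w)\le 0\}$ (assumed nonempty) and $F(z)=f(z)+\sum_{i}\delta_{S_i}(x_i)$ for $z=(x_1,\dots,x_n)$, where $\delta_{S_i}$ is $0$ on $S_i$ and $\infty$ elsewhere. All norms $\|\cdot\|$ are Euclidean. Let $\partial F$ be the Fréchet subdifferential ($\partial F(x)=\emptyset$ where $F(x)=\infty$); $z$ is a stationary point of $F$ if $0\in\partial F(z)$. A number $\theta\in[0,1)$ is a Łojasiewicz exponent of $F$ at a stationary point $\bar z$ if there are $c,\eta>0$ with $|F(z)-F(\bar z)|^\theta\le c\,\mathrm{dist}(0,\partial F(z))$ whenever $\|z-\bar z\|\le\eta$ (convention $0^0=0$, $\mathrm{dist}(0,\emptyset)=\infty$). Fix $\bar\varepsilon>0$, $\gamma>1$, $\ell>1$, and let $\bar S_i=\{w:\mathrm{dist}(w,S_i)\le\bar\varepsilon\}$. Assume: 1. for each $i$ there is $L_i>0$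 with $\|\nabla_i f(z_1)-\nabla_i f(z_2)\|\le L_i\|z_1-z_2\|$ for all $z_1,z_2\in\prod_j\bar S_j$; put $L=\max_i L_i$, $M_l=\gamma L$, and let $M_u\ge M_l$; 2. for each $i$, $S_i$ is convex and compact, $h_i$ is affine or there is $\hat x_i$ with $h_i(\hat x_i)<0$, and for some $\tilde c_i\ge0$, $\mathrm{dist}(x,S_i)\le\tilde c_i\|\max\{h_i(x),0\}\|$ for all $x$ with $\mathrm{dist}(x,\bar S_i)\le M_l^{-1}\sup_{z\in\prod_j\bar S_j}\|\nabla_i f(z)\|$; 3. at each of its stationary points $F$ has some Łojasiewicz exponent in $[0,1)$. **Algorithm.** Let $\varepsilon^{(k)}=\bar\varepsilon/(k+1)^{\ell}$, let $z^{(0)}$ be arbitrary, $\sigma_i^{(k)}\in[M_l,M_u]$, and let $z^{(k)}=(x_i^{(k)})_{i}$, $k\ge0$, be such that for all $k\ge0$ and all $i$ there is $\lambda\in\mathbb R^{p_i}$, $\lambda\ge0$, with $\sqrt{r_i(x_i^{(k+1)},\lambda,\tilde x_i^{(k)})}\le\varepsilon^{(k)}$, where, with $g_i^{(k)}=\nabla_i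 f(x_1^{(k+1)},\dots,x_{i-1}^{(k+1)},x_i^{(k)},\dots,x_n^{(k)})$, $\tilde x_i^{(k)}=x_i^{(k)}-g_i^{(k)}/\sigma_i^{(k)}$ and, with $\nabla h_i(x)\lambda=\sum_j\lambda_j\nabla h_{i,j}(x)$, $$r_i(x,\lambda,\tilde x)=\max\{\langle x,x-\tilde x+\nabla h_i(x)\lambda\rangle,0\}+\|x-\tilde x+\nabla h_i(x)\lambda\|_\infty+\|\max\{h_i(x),0\}\|_\infty+\max\{-\langle\lambda,h_i(x)\rangle,0\}.$$ Let $\bar z^{(k+1)}=(\bar x_i^{(k+1)})_i$, $k\ge0$, consist of the exact solutions $\bar x_i^{(k+1)}=\arg\min_{x\in S_i}\langle g_i^{(k)},x-x_i^{(k)}\rangle+\frac{\sigma_i^{(k)}}2\|x-x_i^{(k)}\|^2$. With $\nu=\frac{12}{\gamma-1}$ put $$C_1^{(k)}=\tfrac12\Big(\max_i\sigma_i^{(k)}+L\big[\tfrac\nu2n^2+(2+\tfrac2\nu-\tfrac\nu2)n+2\nu+\tfrac4\nu+3\big]\Big),\quad u^{(k)}=\sum_{t=k}^\infty C_1^{(t)}\|\bar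 z^{(t)}-z^{(t)}\|^2,\quad v^{(k)}=F(\bar z^{(k)})+u^{(k)}+u^{(k+1)}\quad(k\ge1).$$ **Theorem.** The series $u^{(k)}$ converge, $v^{(k)}$ converges to some $\bar F\in\mathbb R$, and $z^{(k)}$ converges to a stationary point $\bar z$ of $F$. Suppose moreover that $v^{(k)}>\bar F$ for all $k\ge1$, and let $\theta\in[0,1)$ be a Łojasiewicz exponent of $F$ at $\bar z$. Then, as $k\to\infty$, $$\|z^{(k)}-\bar z\|=\begin{cases}O\big(k^{-\frac{1-\theta}{2\theta-1}}\big),&\text{if }\theta\in(\tfrac12,1)\text{ and }\ell\ge\frac{\theta}{2\theta-1},\\[2pt] O\big(k^{-(\ell-1)}\big),&\text{otherwise.}\end{cases}$$ -/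

import Mathlib

open Filter Topology Asymptotics Set

/-- The Cartesian product of Euclidean spaces of dimensions `m i`, with its Euclidean structure. -/
abbrev Blocks {n : ℕ} (m : Fin n → ℕ) : Type :=
  PiLp 2 fun i => EuclideanSpace ℝ (Fin (m i))

section Subdifferential

variable {E : Type*} [NormedAddCommGroup E] [InnerProductSpace ℝ E]

/-- Fréchet subdifferential of an extended-valued function: for `x` in the effective domain, all
`u` with `liminf_{y → x, y ≠ x} (G y - G x - ⟪u, y - x⟫) / ‖y - x‖ ≥ 0`, which is spelled out as:
for every `ε > 0`, `G y ≥ G x + ⟪u, y - x⟫ - ε ‖y - x‖` for all `y` near `x`.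
It is empty outside the effective domain. -/
def frechetSubdiff (G : E → EReal) (x : E) : Set E :=
  {u | G x < ⊤ ∧ ∀ ε : ℝ, 0 < ε →
    ∀ᶠ y in 𝓝 x, G x + ((inner ℝ u (y - x) - ε * ‖y - x‖ : ℝ) : EReal) ≤ G y}

/-- Stationary point: `0 ∈ ∂G(x)`. -/
def IsStationaryPt (G : E → EReal) (x : E) : Prop :=
  (0 : E) ∈ frechetSubdiff G x

open Classical in
/-- `θ ∈ [0,1)` is a Łojasiewicz exponent of `G` at `xbar`: there are `c, η > 0` such that
`|G x - G xbar| ^ θ ≤ c * dist(0, ∂G(x))` on the closed ball of radius `η`. The left-hand side is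
`0` when `G x = G xbar` (convention `0 ^ 0 = 0`), and `dist(0, ∅) = ∞`. -/
def IsLojasiewiczExponent (G : E → EReal) (xbar : E) (θ : ℝ) : Prop :=
  0 ≤ θ ∧ θ < 1 ∧ ∃ c > (0 : ℝ), ∃ η > (0 : ℝ), ∀ x ∈ Metric.closedBall xbar η,
    (if G x = G xbar then 0 else (G x - G xbar).abs ^ θ) ≤
      ENNReal.ofReal c * Metric.infEDist (0 : E) (frechetSubdiff G x)

/-- The Łojasiewicz property at a point: some exponent in `[0,1)` works there. -/
def HasLojasiewiczProperty (G : E → EReal) (xbar : E) : Prop :=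
  ∃ θ : ℝ, IsLojasiewiczExponent G xbar θ

end Subdifferential

open Classical in
/-- Indicator function `δ_S` of a set: `0` on `S` and `∞` outside. -/
noncomputable def setIndicator {E : Type*} (S : Set E) (w : E) : EReal :=
  if w ∈ S then 0 else ⊤

/-- Data of the problem `min f(x_1, …, x_n)` subject to `h_i(x_i) ≤ 0`, with `f` differentiable and
all component functions of `h_i` convex and differentiable. -/
structure BlockProblem (n : ℕ) where
  m : Fin n → ℕ
  p : Fin n → ℕ
  f : Blocks m → ℝ
  h : ∀ i, EuclideanSpace ℝ (Fin (m i)) → Fin (p i) → ℝ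
  differentiable_f : Differentiable ℝ f
  convexOn_h : ∀ i j, ConvexOn ℝ Set.univ fun x => h i x j
  differentiable_h : ∀ i j, Differentiable ℝ fun x => h i x j

namespace BlockProblem

variable {n : ℕ} (P : BlockProblem n)

/-- The space `ℝ^{m_i}` of the `i`-th block. -/
abbrev Block (i : Fin n) : Type := EuclideanSpace ℝ (Fin (P.m i))

/-- The space of all variables. -/
abbrev Space : Type := Blocks P.m

/-- The feasible set `S_i = {w : h_i(w) ≤ 0}`. -/
def S (i : Fin n) : Set (P.Block i) := {w | ∀ j, P.h i w j ≤ 0}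

/-- The extended-valued objective `F = f + ∑ δ_{S_i}`. -/
noncomputable def F (z : P.Space) : EReal :=
  (P.f z : EReal) + ∑ i, setIndicator (P.S i) (z i)

/-- The partial gradient `∇_i f(z)`. -/
noncomputable def gradBlock (i : Fin n) (z : P.Space) : P.Block i :=
  (gradient P.f z) i

/-- `Sbar_i = {w : dist(w, S_i) ≤ εbar}`. -/
def Sbar (εbar : ℝ) (i : Fin n) : Set (P.Block i) :=
  Metric.cthickening εbar (P.S i)

/-- The product of the sets `Sbar_i`. -/
def SbarProd (εbar : ℝ) : Set P.Space := {z | ∀ i, z i ∈ P.Sbar εbar i}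

/-- `sup` of `‖∇_i f‖` over the product of the sets `Sbar_i`. -/
noncomputable def gradSup (εbar : ℝ) (i : Fin n) : ℝ :=
  sSup ((fun z => ‖P.gradBlock i z‖) '' P.SbarProd εbar)

/-- `Stilde_i = {w : dist(w, Sbar_i) ≤ gradSup_i / Ml}`. -/
noncomputable def Stilde (εbar Ml : ℝ) (i : Fin n) : Set (P.Block i) :=
  Metric.cthickening (P.gradSup εbar i / Ml) (P.Sbar εbar i)

/-- Each partial gradient `∇_i f` is Lipschitz, with modulus `Lip i > 0`, over the product of the
sets `Sbar_i`. -/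
def BlockLipschitz (εbar : ℝ) (Lip : Fin n → ℝ) : Prop :=
  ∀ i, 0 < Lip i ∧ ∀ z₁ ∈ P.SbarProd εbar, ∀ z₂ ∈ P.SbarProd εbar,
    ‖P.gradBlock i z₁ - P.gradBlock i z₂‖ ≤ Lip i * ‖z₁ - z₂‖

/-- The constraint map `h_i` is linear (that is, affine). -/
def AffineConstraint (i : Fin n) : Prop :=
  ∃ A : P.Block i →ᵃ[ℝ] (Fin (P.p i) → ℝ), ∀ x, P.h i x = A x

/-- Slater's constraint qualification. -/
def Slater (i : Fin n) : Prop :=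
  ∃ x : P.Block i, ∀ j, P.h i x j < 0

/-- The Hoffman-like bound `dist(x, S_i) ≤ c ‖max{h_i(x), 0}‖` on `Stilde_i`, with the Euclidean
norm on the right. -/
def HoffmanBound (εbar Ml : ℝ) (i : Fin n) : Prop :=
  ∃ c : ℝ, 0 ≤ c ∧ ∀ x ∈ P.Stilde εbar Ml i,
    Metric.infDist x (P.S i) ≤ c * ‖(WithLp.toLp 2 fun j => max (P.h i x j) 0 :
      EuclideanSpace ℝ (Fin (P.p i)))‖

/-- The assumptions on the feasible sets and on the constraint maps. -/
structure ConstraintAssumption (εbar Ml : ℝ) : Prop where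
  nonempty : ∀ i, (P.S i).Nonempty
  convex : ∀ i, Convex ℝ (P.S i)
  compact : ∀ i, IsCompact (P.S i)
  qualification : ∀ i, P.AffineConstraint i ∨ P.Slater i
  hoffman : ∀ i, P.HoffmanBound εbar Ml i

/-- `F` has the Łojasiewicz property at each of its stationary points. -/
def LojasiewiczAssumption : Prop :=
  ∀ z : P.Space, IsStationaryPt P.F z → HasLojasiewiczProperty P.F z

/-- The vector `∇h_i(x) λ = ∑_j λ_j ∇h_{i,j}(x)`. -/
noncomputable def jacMul (i : Fin n) (x : P.Block i) (lam : Fin (P.p i) → ℝ) : P.Block i :=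
  ∑ j, lam j • gradient (fun y => P.h i y j) x

/-- The residual function `r_i(x, λ, xt)`. Norms of functions `Fin _ → ℝ` are sup norms. -/
noncomputable def residual (i : Fin n) (x : P.Block i) (lam : Fin (P.p i) → ℝ)
    (xt : P.Block i) : ℝ :=
  max (inner ℝ x (x - xt + P.jacMul i x lam)) 0
    + ‖(WithLp.ofLp (x - xt + P.jacMul i x lam) : Fin (P.m i) → ℝ)‖
    + ‖(fun j => max (P.h i x j) 0 : Fin (P.p i) → ℝ)‖
    + max (-∑ j, lam j * P.h i x j) 0

/-- The point `(x_{<i}^{(k+1)}, x_{≥i}^{(k)})`. -/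
noncomputable def mixed (z : ℕ → P.Space) (k : ℕ) (i : Fin n) : P.Space :=
  WithLp.toLp 2 fun j => if j < i then z (k + 1) j else z k j

/-- `xt_i^{(k)} = x_i^{(k)} - (1/σ_i^{(k)}) ∇_i f(x_{<i}^{(k+1)}, x_{≥i}^{(k)})`. -/
noncomputable def gradStep (z : ℕ → P.Space) (σ : ℕ → Fin n → ℝ) (k : ℕ) (i : Fin n) :
    P.Block i :=
  z k i - (1 / σ k i) • P.gradBlock i (P.mixed z k i)

/-- `z` is an (infinite) iterate sequence of the infeasible inexact proximal alternating linearized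
minimization method, with proximal parameters `σ` in `[Ml, Mu]` and tolerances `ε`; the initial
point `z 0` is arbitrary. -/
structure IsIPALM (Ml Mu : ℝ) (ε : ℕ → ℝ) (σ : ℕ → Fin n → ℝ) (z : ℕ → P.Space) : Prop where
  sigma_mem : ∀ k i, σ k i ∈ Set.Icc Ml Mu
  inexact : ∀ k i, ∃ lam : Fin (P.p i) → ℝ, (∀ j, 0 ≤ lam j) ∧
    Real.sqrt (P.residual i (z (k + 1) i) lam (P.gradStep z σ k i)) ≤ ε k

/-- Objective of the `i`-th proximal linearized subproblem at iteration `k`. -/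
noncomputable def proxObjective (z : ℕ → P.Space) (σ : ℕ → Fin n → ℝ) (k : ℕ) (i : Fin n)
    (x : P.Block i) : ℝ :=
  inner ℝ (P.gradBlock i (P.mixed z k i)) (x - z k i) + σ k i / 2 * ‖x - z k i‖ ^ 2

/-- `xbar_i^{(k+1)}`, the exact solution of the `i`-th proximal linearized subproblem. -/
noncomputable def exactBlock (z : ℕ → P.Space) (σ : ℕ → Fin n → ℝ) (k : ℕ) (i : Fin n) :
    P.Block i :=
  Classical.epsilon fun x => x ∈ P.S i ∧ IsMinOn (P.proxObjective z σ k i) (P.S i) x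

theorem exactBlock_spec (z : ℕ → P.Space) (σ : ℕ → Fin n → ℝ) (k : ℕ) (i : Fin n)
    (hne : (P.S i).Nonempty) (hc : IsCompact (P.S i)) :
    P.exactBlock z σ k i ∈ P.S i ∧
      IsMinOn (P.proxObjective z σ k i) (P.S i) (P.exactBlock z σ k i) := by
  have hcont : Continuous (P.proxObjective z σ k i) := by
    unfold proxObjective
    fun_prop
  exact Classical.epsilon_spec (hc.exists_isMinOn hne hcont.continuousOn)

/-- `zbar^{(k)}` for `k ≥ 1`, collecting the exact solutions `xbar_i^{(k)}`. There is no
`zbar^{(0)}`; the value at `0` is a placeholder. -/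
noncomputable def zbar (z : ℕ → P.Space) (σ : ℕ → Fin n → ℝ) : ℕ → P.Space
  | 0 => z 0
  | k + 1 => WithLp.toLp 2 fun i => P.exactBlock z σ k i

end BlockProblem

/-- `C_1^{(k)}` with `ν = 12 / (γ - 1)` and `σ̄^{(k)} = max_i σ_i^{(k)}`. -/
noncomputable def surrogateConst {n : ℕ} (L γ : ℝ) (σ : ℕ → Fin n → ℝ) (k : ℕ) : ℝ :=
  let ν : ℝ := 12 / (γ - 1)
  ((⨆ i, σ k i) + L * (ν / 2 * (n : ℝ) ^ 2 + (2 + 2 / ν - ν / 2) * (n : ℝ)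
    + 2 * ν + 4 / ν + 3)) / 2

namespace BlockProblem

variable {n : ℕ} (P : BlockProblem n)

/-- The terms `C_1^{(t)} ‖zbar^{(t)} - z^{(t)}‖²`. -/
noncomputable def errTerm (L γ : ℝ) (σ : ℕ → Fin n → ℝ) (z : ℕ → P.Space) (t : ℕ) : ℝ :=
  surrogateConst L γ σ t * ‖P.zbar z σ t - z t‖ ^ 2

/-- `u^{(k)} = ∑_{t ≥ k} C_1^{(t)} ‖zbar^{(t)} - z^{(t)}‖²`. -/
noncomputable def errTail (L γ : ℝ) (σ : ℕ → Fin n → ℝ) (z : ℕ → P.Space) (k : ℕ) : ℝ :=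
  ∑' t, P.errTerm L γ σ z (t + k)

/-- The surrogate sequence `v^{(k)} = F(zbar^{(k)}) + u^{(k)} + u^{(k+1)}`, meaningful for
`k ≥ 1`. -/
noncomputable def surrogate (L γ : ℝ) (σ : ℕ → Fin n → ℝ) (z : ℕ → P.Space) (k : ℕ) : EReal :=
  P.F (P.zbar z σ k) + ((P.errTail L γ σ z k + P.errTail L γ σ z (k + 1) : ℝ) : EReal)

end BlockProblem

/-! The argument follows the exact subproblem solutions `zbar` rather than the iterates: they are
feasible, so `F = f` along them, and inexactness becomes a perturbation of a feasible descent
method.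

The residual controls the constraint violation, and since the tolerances vanish, convexity and
compactness force the iterates into the enlarged sets where the gradients are Lipschitz and the
Hoffman bounds hold. There `sq_norm_sub_le_residual` bounds the squared distance from iterate to
exact solution by a multiple of the residual, so `zbar k - z k` is `O(k^(-ℓ))`. With d k the length
of the step from `zbar k` to `zbar (k+1)`, this gives perturbed descent, f(zbar (k+1)) + a (d k)² ≤
f(zbar k) + b k^(-2ℓ) (`f_zbar_succ_le`), and a subgradient at `zbar (k+1)` of size at most a
constant times d k + k^(-ℓ) (`exists_norm_le_and_normal`).

Adding D k^(-(2ℓ-1)) to the objective gap absorbs the errors and gives an exactly decreasing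
quantity r; the matching step measure is s = d + k^(-ℓ). The Łojasiewicz inequality passes to r with
exponent ϑ provided (D k^(-(2ℓ-1)))^ϑ is still `O(k^(-ℓ))`, that is, ϑ ≥ ℓ/(2ℓ-1). As an exponent
may always be raised near the limit, ϑ = max(θ, ℓ/(2ℓ-1)) is admissible. The usual finite-length
argument then gives convergence, with tails of order k^(-(1-ϑ)/(2ϑ-1)). For ϑ = ℓ/(2ℓ-1) this order
is k^(-(ℓ-1)), and the two cases of the theorem record which term attains the maximum. -/

/-! ### Power inequalities and recursions for exact descent. -/

/-- Tangent-line inequality for the concave function t ↦ t^(1-p) at x, multiplied by x^p. Here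
t^(1-p) plays the role of the desingularizing function. -/
theorem sub_mul_le_rpow_mul_sub {p x y : ℝ} (hp0 : 0 ≤ p) (hp1 : p ≤ 1) (hx : 0 < x) (hy : 0 ≤ y) :
    (1 - p) * (x - y) ≤ x ^ p * (x ^ (1 - p) - y ^ (1 - p)) := by
  have hb : (1 + (y / x - 1)) ^ (1 - p) ≤ 1 + (1 - p) * (y / x - 1) :=
    rpow_one_add_le_one_add_mul_self (by have := div_nonneg hy hx.le; linarith)
      (by linarith) (by linarith)
  rw [add_sub_cancel, Real.div_rpow hy hx.le, div_le_iff₀ (Real.rpow_pos_of_pos hx _)] at hb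
  have h1 : x ^ p * x ^ (1 - p) = x := by
    rw [← Real.rpow_add hx]; simp
  have h2 := mul_le_mul_of_nonneg_left hb (Real.rpow_nonneg hx.le p)
  have h3 : x ^ p * ((1 + (1 - p) * (y / x - 1)) * x ^ (1 - p)) = x + (1 - p) * (y - x) := by
    rw [mul_left_comm, h1]; field_simp
  rw [mul_sub (x ^ p), h1]
  linarith

/-- A mean value bound from log(1 + 1/x) ≤ 1/x; the factor 2^(q+1) pays for replacing x by x + 1 ≤
2x. -/
theorem rpow_neg_sub_rpow_neg_le {q : ℝ} (hq : 0 ≤ q) {x : ℝ} (hx : 1 ≤ x) :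
    x ^ (-q) - (x + 1) ^ (-q) ≤ q * 2 ^ (q + 1) * (x + 1) ^ (-(q + 1)) := by
  have hx0 : 0 < x := by linarith
  have h1 : (x + 1) ^ (-q) = x ^ (-q) * (1 + 1 / x) ^ (-q) := by
    rw [← Real.mul_rpow hx0.le (by positivity)]; congr 1; field_simp
  have h2 : 1 - q / x ≤ (1 + 1 / x) ^ (-q) := by
    rw [Real.rpow_def_of_pos (by positivity)]
    have h3 : Real.log (1 + 1 / x) ≤ 1 / x := by
      have := Real.log_le_sub_one_of_pos (show 0 < 1 + 1 / x by positivity); linarith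
    have h4 := Real.add_one_le_exp (Real.log (1 + 1 / x) * -q)
    have h5 := mul_le_mul_of_nonneg_right h3 hq
    have h6 : 1 / x * q = q / x := by ring
    linarith
  have h7 : x ^ (-q) - (x + 1) ^ (-q) ≤ q * x ^ (-(q + 1)) := by
    have h8 : x ^ (-(q + 1)) = x ^ (-q) / x := by
      rw [neg_add, Real.rpow_add hx0, Real.rpow_neg_one]; rfl
    have h9 := mul_le_mul_of_nonneg_left h2 (Real.rpow_nonneg hx0.le (-q))
    rw [h1, h8]
    have : x ^ (-q) * (1 - q / x) = x ^ (-q) - q * (x ^ (-q) / x) := by ring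
    linarith
  have h10 : x ^ (-(q + 1)) ≤ 2 ^ (q + 1) * (x + 1) ^ (-(q + 1)) := by
    have h11 : (2 * x) ^ (-(q + 1)) ≤ (x + 1) ^ (-(q + 1)) :=
      Real.rpow_le_rpow_of_nonpos (by positivity) (by linarith) (by linarith)
    rw [Real.mul_rpow (by norm_num) hx0.le, Real.rpow_neg (by norm_num : (0 : ℝ) ≤ 2)] at h11
    have h12 : (0 : ℝ) < 2 ^ (q + 1) := by positivity
    calc x ^ (-(q + 1)) = 2 ^ (q + 1) * ((2 ^ (q + 1))⁻¹ * x ^ (-(q + 1))) := by field_simp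
      _ ≤ _ := by gcongr
  calc _ ≤ _ := h7
    _ ≤ q * (2 ^ (q + 1) * (x + 1) ^ (-(q + 1))) := by gcongr
    _ = _ := by ring

theorem mul_rpow_le_rpow_neg_sub {q : ℝ} (hq : 1 ≤ q) {x : ℝ} (hx : 1 ≤ x) :
    q * 2⁻¹ ^ q * x ^ (-(q + 1)) ≤ x ^ (-q) - (x + 1) ^ (-q) := by
  have hx0 : 0 < x := by linarith
  have h1 : x ^ (-q) = (x + 1) ^ (-q) * (1 + 1 / x) ^ q := by
    rw [show 1 + 1 / x = (x + 1) / x by field_simp, Real.div_rpow (by linarith) hx0.le,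
      Real.rpow_neg hx0.le,
      Real.rpow_neg (show 0 ≤ x + 1 by linarith)]
    have : (x + 1) ^ q ≠ 0 := by positivity
    field_simp
  have h2 : 1 + q * (1 / x) ≤ (1 + 1 / x) ^ q :=
    one_add_mul_self_le_rpow_one_add (by have : 0 < 1 / x := by positivity
                                         linarith) hq
  have h3 : 2⁻¹ ^ q * x ^ (-q) ≤ (x + 1) ^ (-q) := by
    have h11 : (2 * x) ^ (-q) ≤ (x + 1) ^ (-q) :=
      Real.rpow_le_rpow_of_nonpos (by positivity) (by linarith) (by linarith)
    rwa [Real.mul_rpow (by norm_num) hx0.le, Real.rpow_neg_eq_inv_rpow] at h11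
  have h8 : x ^ (-(q + 1)) = x ^ (-q) / x := by
    rw [neg_add, Real.rpow_add hx0, Real.rpow_neg_one]; rfl
  have h4 := mul_le_mul_of_nonneg_left h2 (show 0 ≤ (x + 1) ^ (-q) by positivity)
  rw [← h1] at h4
  calc _ = (q / x) * (2⁻¹ ^ q * x ^ (-q)) := by rw [h8]; ring
    _ ≤ (q / x) * (x + 1) ^ (-q) := by gcongr
    _ = (x + 1) ^ (-q) * (1 + q * (1 / x)) - (x + 1) ^ (-q) := by ring
    _ ≤ _ := by linarith

/-- Decay of a nonnegative sequence with `a (k + 1) ^ p ≤ M * (a k - a (k + 1))`, `p > 1`. -/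
theorem le_mul_rpow_of_rpow_succ_le {a : ℕ → ℝ} {p M : ℝ} (hp : 1 < p) (hM : 0 < M)
    (h : ∀ k, a (k + 1) ^ p ≤ M * (a k - a (k + 1))) :
    ∃ C, 0 < C ∧ ∀ k : ℕ, a k ≤ C * ((k : ℝ) + 1) ^ (-(1 / (p - 1))) := by
  set q := 1 / (p - 1) with hq
  have hp' : 0 < p - 1 := by linarith
  have hq0 : 0 < q := by positivity
  have hqp : q * p = q + 1 := by rw [hq]; field_simp; ring
  -- Chosen so that c^(p-1) = M q 2^(q+1): then C (k+1)^(-q) decreases no faster than the recursion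
  -- demands. If a (k+1) exceeded its bound, the forced decrease would make a k exceed its own.
  set c := (M * (q * 2 ^ (q + 1))) ^ q with hc
  have hc0 : 0 < c := by positivity
  set C := max (a 0) c with hC
  have hC0 : 0 < C := lt_max_of_lt_right hc0
  have hCp : M * (q * 2 ^ (q + 1)) ≤ C ^ (p - 1) := by
    have h1 : c ^ (p - 1) = M * (q * 2 ^ (q + 1)) := by
      rw [hc, ← Real.rpow_mul (by positivity), hq, one_div_mul_cancel hp'.ne', Real.rpow_one]
    rw [← h1]
    exact Real.rpow_le_rpow hc0.le (le_max_right _ _) hp'.le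
  refine ⟨C, hC0, fun k => ?_⟩
  induction k with
  | zero => simp [hC]
  | succ k ih =>
    by_contra! hlt
    push_cast at hlt
    set x : ℝ := (k : ℝ) + 1 with hx
    have hx1 : 1 ≤ x := by rw [hx]; have := Nat.cast_nonneg (α := ℝ) k; linarith
    have h2 := rpow_neg_sub_rpow_neg_le hq0.le hx1
    have h3 : (C * (x + 1) ^ (-q)) ^ p ≤ a (k + 1) ^ p :=
      Real.rpow_le_rpow (by positivity) hlt.le (by linarith)
    rw [Real.mul_rpow hC0.le (by positivity), ← Real.rpow_mul (by positivity), neg_mul, hqp] at h3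
    have h4 := h k
    have h5 : M * (C * (q * 2 ^ (q + 1) * (x + 1) ^ (-(q + 1)))) ≤ C ^ p * (x + 1) ^ (-(q + 1)) := by
      have : C ^ p = C * C ^ (p - 1) := by
        rw [Real.rpow_sub_one hC0.ne']; field_simp
      rw [this]
      calc _ = C * (M * (q * 2 ^ (q + 1))) * (x + 1) ^ (-(q + 1)) := by ring
        _ ≤ _ := by gcongr
    have h6 : M * (C * (q * 2 ^ (q + 1) * (x + 1) ^ (-(q + 1)))) ≤ M * (a k - a (k + 1)) := by
      linarith
    have h7 := le_of_mul_le_mul_left h6 hM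
    have h8 := mul_le_mul_of_nonneg_left h2 hC0.le
    rw [mul_sub] at h8
    linarith

/-- Finite length from sufficient decrease and a Łojasiewicz inequality. -/
theorem summable_of_rpow_succ_le {r s : ℕ → ℝ} {A B θ : ℝ} (hθ0 : 0 < θ) (hθ1 : θ < 1)
    (hA : 0 < A) (hB : 0 < B) (hs : ∀ k, 0 < s k) (hr : ∀ k, 0 ≤ r k)
    (hdec : ∀ k, s k ^ 2 ≤ A * (r k - r (k + 1))) (hkl : ∀ k, r (k + 1) ^ θ ≤ B * s k) :
    Summable s ∧
      ∀ k, ∑' j, s (j + (k + 1)) ≤ s k + A * B / (1 - θ) * r (k + 1) ^ (1 - θ) := by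
  set M := A * B / (1 - θ) with hM
  have hθ : 0 < 1 - θ := by linarith
  have hM0 : 0 < M := by positivity
  have hlt : ∀ k, r (k + 1) < r k := fun k => by
    have h1 : 0 < A * (r k - r (k + 1)) := lt_of_lt_of_le (pow_pos (hs k) 2) (hdec k)
    have := (mul_pos_iff_of_pos_left hA).1 h1
    linarith
  -- Strict positivity of s makes r strictly decreasing, hence never zero; the tangent-line
  -- inequality needs this.
  have hrpos : ∀ k, 0 < r k := fun k => lt_of_le_of_lt (hr _) (hlt k)
  have key : ∀ k, 2 * s (k + 1) ≤
      s k + M * (r (k + 1) ^ (1 - θ) - r (k + 2) ^ (1 - θ)) := fun k => by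
    set m := M * (r (k + 1) ^ (1 - θ) - r (k + 2) ^ (1 - θ)) with hm
    have hψ : 0 ≤ r (k + 1) ^ (1 - θ) - r (k + 2) ^ (1 - θ) :=
      sub_nonneg.2 (Real.rpow_le_rpow (hr _) (hlt (k + 1)).le hθ.le)
    have h1 := sub_mul_le_rpow_mul_sub hθ0.le hθ1.le (hrpos (k + 1)) (hr (k + 2))
    have h2 : (1 - θ) * (r (k + 1) - r (k + 2)) ≤
        B * s k * (r (k + 1) ^ (1 - θ) - r (k + 2) ^ (1 - θ)) :=
      h1.trans (mul_le_mul_of_nonneg_right (hkl k) hψ)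
    have h3 : s (k + 1) ^ 2 ≤ s k * m := by
      refine (hdec (k + 1)).trans ?_
      have h4 : r (k + 1) - r (k + 2) ≤
        B * s k * (r (k + 1) ^ (1 - θ) - r (k + 2) ^ (1 - θ)) / (1 - θ) := by
        rw [le_div_iff₀ hθ]; linarith
      calc _ ≤ A * (B * s k * (r (k + 1) ^ (1 - θ) - r (k + 2) ^ (1 - θ)) / (1 - θ)) :=
            mul_le_mul_of_nonneg_left h4 hA.le
        _ = _ := by rw [hm, hM]; ring
    have hm0 : 0 ≤ m := mul_nonneg hM0.le hψ
    -- From s (k+1)² ≤ s k · m, AM-GM gives 2 s (k+1) ≤ s k + m.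
    refine abs_le_of_sq_le_sq' ?_ (by linarith [hs k]) |>.2
    nlinarith [sq_nonneg (s k - m)]
  have hpart : ∀ k N, ∑ j ∈ Finset.range N, s (j + (k + 1)) + s (k + N) +
      M * r (k + N + 1) ^ (1 - θ) ≤ s k + M * r (k + 1) ^ (1 - θ) := fun k N => by
    induction N with
    | zero => simp
    | succ N ih =>
      rw [Finset.sum_range_succ]
      have h1 := key (k + N)
      rw [mul_sub] at h1
      have e1 : N + (k + 1) = k + N + 1 := by ring
      have e2 : k + (N + 1) = k + N + 1 := by ring
      rw [e1, e2]
      linarith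
  have hbound : ∀ k N, ∑ j ∈ Finset.range N, s (j + (k + 1)) ≤
      s k + M * r (k + 1) ^ (1 - θ) := fun k N => by
    have := hpart k N
    have h1 := hs (k + N)
    have h2 : 0 ≤ M * r (k + N + 1) ^ (1 - θ) := mul_nonneg hM0.le (Real.rpow_nonneg (hr _) _)
    linarith
  have hsum : ∀ k, Summable fun j => s (j + (k + 1)) := fun k =>
    summable_of_sum_range_le (fun j => (hs _).le) (hbound k)
  refine ⟨(summable_nat_add_iff 1).1 (hsum 0), fun k => ?_⟩
  exact Real.tsum_le_of_sum_range_le (fun j => (hs _).le) (hbound k)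

/-- Rate of decay of the tails in `summable_of_rpow_succ_le` when `θ > 1/2`. -/
theorem tsum_tail_le_of_rpow_succ_le {r s : ℕ → ℝ} {A B θ : ℝ} (hθ0 : 1 / 2 < θ) (hθ1 : θ < 1)
    (hA : 0 < A) (hB : 0 < B) (hs : ∀ k, 0 < s k) (hr : ∀ k, 0 ≤ r k)
    (hdec : ∀ k, s k ^ 2 ≤ A * (r k - r (k + 1))) (hkl : ∀ k, r (k + 1) ^ θ ≤ B * s k) :
    ∃ C, 0 < C ∧ ∀ k : ℕ, ∑' j, s (j + (k + 1)) ≤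
      C * ((k : ℝ) + 1) ^ (-((1 - θ) / (2 * θ - 1))) := by
  have hθ : 0 < 1 - θ := by linarith
  have h2θ : 0 < 2 * θ - 1 := by linarith
  obtain ⟨-, htail⟩ := summable_of_rpow_succ_le (by linarith) hθ1 hA hB hs hr hdec hkl
  have hrec : ∀ k, r (k + 1) ^ (2 * θ) ≤ B ^ 2 * A * (r k - r (k + 1)) := fun k => by
    rw [mul_comm 2 θ, Real.rpow_mul (hr _), show (2 : ℝ) = ((2 : ℕ) : ℝ) by norm_num,
      Real.rpow_natCast]
    calc _ ≤ (B * s k) ^ 2 := pow_le_pow_left₀ (Real.rpow_nonneg (hr _) _) (hkl k) 2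
      _ = B ^ 2 * s k ^ 2 := by ring
      _ ≤ B ^ 2 * (A * (r k - r (k + 1))) := by gcongr; exact hdec k
      _ = _ := by ring
  obtain ⟨C, hC, hCr⟩ := le_mul_rpow_of_rpow_succ_le (by linarith) (by positivity) hrec
  set M := A * B / (1 - θ) with hM
  have hM0 : 0 < M := by positivity
  set q := (1 - θ) / (2 * θ - 1) with hq
  refine ⟨Real.sqrt (A * C) + M * C ^ (1 - θ), by positivity, fun k => (htail k).trans ?_⟩
  set x : ℝ := (k : ℝ) + 1 with hx
  have hx1 : 1 ≤ x := by rw [hx]; have := Nat.cast_nonneg (α := ℝ) k; linarith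
  have hx0 : 0 < x := by linarith
  have hmono : r (k + 1) ≤ r k := by
    have h1 : 0 ≤ A * (r k - r (k + 1)) := (sq_nonneg _).trans (hdec k)
    have := (mul_nonneg_iff_of_pos_left hA).1 h1
    linarith
  have h1 : s k ≤ Real.sqrt (A * C) * x ^ (-q) := by
    have h2 : s k ^ 2 ≤ A * C * x ^ (-(1 / (2 * θ - 1))) := by
      calc _ ≤ A * (r k - r (k + 1)) := hdec k
        _ ≤ A * (C * x ^ (-(1 / (2 * θ - 1)))) := by
            gcongr; linarith [hCr k, hr (k + 1)]
        _ = _ := by ring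
    refine abs_le_of_sq_le_sq' ?_ (by positivity) |>.2
    rw [mul_pow, Real.sq_sqrt (by positivity)]
    refine h2.trans ?_
    gcongr
    rw [← Real.rpow_natCast, ← Real.rpow_mul hx0.le]
    -- The bound on s k has exponent 1/(2(2θ-1)), which is at least q because 1 - θ ≤ 1/2.
    refine Real.rpow_le_rpow_of_exponent_le hx1 ?_
    rw [hq]
    push_cast
    rw [neg_mul, neg_le_neg_iff, div_mul_eq_mul_div]
    gcongr
    linarith
  have h3 : r (k + 1) ^ (1 - θ) ≤ C ^ (1 - θ) * x ^ (-q) := by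
    calc _ ≤ (C * x ^ (-(1 / (2 * θ - 1)))) ^ (1 - θ) :=
          Real.rpow_le_rpow (hr _) (hmono.trans (hCr k)) hθ.le
      _ = _ := by
          rw [Real.mul_rpow hC.le (by positivity), ← Real.rpow_mul hx0.le, hq]
          congr 2; ring
  calc _ ≤ Real.sqrt (A * C) * x ^ (-q) + M * (C ^ (1 - θ) * x ^ (-q)) := by gcongr
    _ = _ := by ring

/-! ### Descent with perturbations of order k^(-2ℓ). -/

/-- The error x^(-2ℓ) is dominated by the decrease of a multiple of x^(-(2ℓ-1)). Using b + 1 instead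
of b leaves a spare x^(-2ℓ), which later pays for the k^(-ℓ) part of s. -/
theorem exists_mul_sq_rpow_neg_le_sub {ℓ : ℝ} (hℓ : 1 < ℓ) {b : ℝ} (hb : 0 ≤ b) :
    ∃ D, 0 < D ∧ ∀ x : ℝ, 1 ≤ x →
      (b + 1) * (x ^ (-ℓ)) ^ 2 ≤ D * (x ^ (-(2 * ℓ - 1)) - (x + 1) ^ (-(2 * ℓ - 1))) := by
  have hq : 1 ≤ 2 * ℓ - 1 := by linarith
  set e : ℝ := (2 * ℓ - 1) * 2⁻¹ ^ (2 * ℓ - 1) with he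
  have he0 : 0 < e := by positivity
  refine ⟨(b + 1) / e, by positivity, fun x hx => ?_⟩
  have h := mul_rpow_le_rpow_neg_sub hq hx
  have h1 : (x ^ (-ℓ)) ^ 2 = x ^ (-(2 * ℓ - 1 + 1)) := by
    rw [← Real.rpow_natCast, ← Real.rpow_mul (by linarith)]
    congr 1; push_cast; ring
  rw [h1]
  calc _ = (b + 1) / e * (e * x ^ (-(2 * ℓ - 1 + 1))) := by field_simp
    _ ≤ _ := by gcongr

theorem tendsto_nat_rpow_neg {q : ℝ} (hq : 0 < q) :
    Tendsto (fun k : ℕ => (k : ℝ) ^ (-q)) atTop (𝓝 0) :=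
  (tendsto_rpow_neg_atTop hq).comp tendsto_natCast_atTop_atTop

section RealSequences

variable {φ d : ℕ → ℝ} {a b ℓ : ℝ} {N : ℕ}

theorem exists_tendsto_of_perturbed_descent (ha : 0 < a) (hb : 0 ≤ b) (hℓ : 1 < ℓ)
    (hdec : ∀ k ≥ N, φ (k + 1) + a * d k ^ 2 ≤ φ k + b * ((k : ℝ) ^ (-ℓ)) ^ 2)
    (hbdd : ∃ m, ∀ k ≥ N, m ≤ φ k) :
    ∃ Fl, Tendsto φ atTop (𝓝 Fl) := by
  obtain ⟨D, hD, hDx⟩ := exists_mul_sq_rpow_neg_le_sub hℓ hb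
  obtain ⟨m, hm⟩ := hbdd
  set ψ : ℕ → ℝ := fun k => φ k + D * (k : ℝ) ^ (-(2 * ℓ - 1)) with hψ
  have hanti : Antitone fun k => ψ (k + (N + 1)) := by
    refine antitone_nat_of_succ_le fun k => ?_
    have h1 := hdec (k + (N + 1)) (by omega)
    have h2 := hDx ((k + (N + 1) : ℕ) : ℝ) (by exact_mod_cast (by omega : 1 ≤ k + (N + 1)))
    have h3 : 0 ≤ a * d (k + (N + 1)) ^ 2 := by positivity
    have h4 : 0 ≤ (((k + (N + 1) : ℕ) : ℝ) ^ (-ℓ)) ^ 2 := by positivity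
    have e : k + 1 + (N + 1) = k + (N + 1) + 1 := by ring
    simp only [hψ, e]
    rw [Nat.cast_succ (k + (N + 1))]
    linarith
  have hlow : BddBelow (range fun k => ψ (k + (N + 1))) := by
    refine ⟨m, ?_⟩
    rintro _ ⟨k, rfl⟩
    have h1 := hm (k + (N + 1)) (by omega)
    have h2 : 0 ≤ D * ((k + (N + 1) : ℕ) : ℝ) ^ (-(2 * ℓ - 1)) := by positivity
    simp only [hψ]; linarith
  have ht := (tendsto_add_atTop_iff_nat (N + 1)).1 (tendsto_atTop_ciInf hanti hlow)
  have h0 := (tendsto_nat_rpow_neg (show 0 < 2 * ℓ - 1 by linarith)).const_mul D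
  refine ⟨_, (ht.sub h0).congr fun k => ?_⟩
  simp [hψ]

theorem tendsto_zero_of_perturbed_descent (ha : 0 < a) (hℓ : 1 < ℓ) (hd : ∀ k, 0 ≤ d k)
    (hdec : ∀ k ≥ N, φ (k + 1) + a * d k ^ 2 ≤ φ k + b * ((k : ℝ) ^ (-ℓ)) ^ 2)
    {Fl : ℝ} (hlim : Tendsto φ atTop (𝓝 Fl)) : Tendsto d atTop (𝓝 0) := by
  have h1 : Tendsto (fun k => (φ k - φ (k + 1) + b * ((k : ℝ) ^ (-ℓ)) ^ 2) / a) atTop (𝓝 0) := by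
    have h2 := (hlim.sub ((tendsto_add_atTop_iff_nat 1).2 hlim)).add
      (((tendsto_nat_rpow_neg (show 0 < ℓ by linarith)).pow 2).const_mul b)
    simpa using h2.div_const a
  have h3 : Tendsto (fun k => d k ^ 2) atTop (𝓝 0) := by
    refine squeeze_zero' (Eventually.of_forall fun k => sq_nonneg _) ?_ h1
    filter_upwards [eventually_ge_atTop N] with k hk
    rw [le_div_iff₀ ha]
    linarith [hdec k hk]
  have h4 := h3.sqrt
  simpa [Real.sqrt_sq (hd _)] using h4

/-- Length and rate for a perturbed descent sequence satisfying a Łojasiewicz inequality. -/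
theorem summable_and_isBigO_of_perturbed_descent (ha : 0 < a) (hb : 0 ≤ b) (hℓ : 1 < ℓ)
    (hd : ∀ k, 0 ≤ d k)
    (hdec : ∀ k ≥ N, φ (k + 1) + a * d k ^ 2 ≤ φ k + b * ((k : ℝ) ^ (-ℓ)) ^ 2)
    {Fl c θ : ℝ} (hlim : Tendsto φ atTop (𝓝 Fl)) (hθ : ℓ / (2 * ℓ - 1) ≤ θ) (hθ1 : θ < 1)
    (hc : 0 < c)
    (hkl : ∀ᶠ k : ℕ in atTop, |φ (k + 1) - Fl| ^ θ ≤ c * (d k + (k : ℝ) ^ (-ℓ))) :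
    Summable d ∧ (fun k => ∑' j, d (j + k)) =O[atTop]
      fun k : ℕ => (k : ℝ) ^ (-((1 - θ) / (2 * θ - 1))) := by
  obtain ⟨D, hD, hDx⟩ := exists_mul_sq_rpow_neg_le_sub hℓ hb
  obtain ⟨N₀, hN₀⟩ := eventually_atTop.1 hkl
  have hq : 0 < 2 * ℓ - 1 := by linarith
  have hqθ : ℓ ≤ θ * (2 * ℓ - 1) := (div_le_iff₀ hq).1 hθ
  have hθhalf : 1 / 2 < θ := by nlinarith
  have hθ0 : 0 < θ := by linarith
  -- The shift makes all eventual hypotheses hold from index 0 and keeps X k ≥ 1.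
  set n := max N N₀ + 1 with hn
  have hnN : N ≤ n := by omega
  have hnN₀ : N₀ ≤ n := by omega
  set X : ℕ → ℝ := fun k => ((k + n : ℕ) : ℝ) with hX
  have hX1 : ∀ k, 1 ≤ X k := fun k => by
    simp only [hX]; exact_mod_cast (by omega : 1 ≤ k + n)
  have hX0 : ∀ k, 0 < X k := fun k => by linarith [hX1 k]
  have hXs : ∀ k, X (k + 1) = X k + 1 := fun k => by simp only [hX]; push_cast; ring
  set r : ℕ → ℝ := fun k => φ (k + n) - Fl + D * X k ^ (-(2 * ℓ - 1)) with hr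
  set s : ℕ → ℝ := fun k => d (k + n) + X k ^ (-ℓ) with hs
  have hspos : ∀ k, 0 < s k := fun k => by
    have := Real.rpow_pos_of_pos (hX0 k) (-ℓ)
    have := hd (k + n)
    simp only [hs]; linarith
  have hrdec : ∀ k, a * d (k + n) ^ 2 + (X k ^ (-ℓ)) ^ 2 ≤ r k - r (k + 1) := fun k => by
    have h1 := hdec (k + n) (by omega)
    have h2 := hDx (X k) (hX1 k)
    have e : k + 1 + n = k + n + 1 := by ring
    simp only [hr, hXs, e]
    change φ (k + n + 1) + a * d (k + n) ^ 2 ≤ φ (k + n) + b * (X k ^ (-ℓ)) ^ 2 at h1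
    linarith
  have hranti : Antitone r := antitone_nat_of_succ_le fun k => by
    have h1 := hrdec k
    have : 0 ≤ a * d (k + n) ^ 2 + (X k ^ (-ℓ)) ^ 2 := by positivity
    linarith
  have hr0 : ∀ k, 0 ≤ r k := by
    refine hranti.le_of_tendsto ?_
    have h1 := ((tendsto_nat_rpow_neg hq).const_mul D)
    have h2 : Tendsto (fun k : ℕ => φ k - Fl + D * (k : ℝ) ^ (-(2 * ℓ - 1))) atTop (𝓝 0) := by
      simpa using (hlim.sub_const Fl).add h1
    exact (tendsto_add_atTop_iff_nat n).2 h2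
  set A := 2 / a + 2 with hA
  have hA0 : 0 < A := by positivity
  have hsdec : ∀ k, s k ^ 2 ≤ A * (r k - r (k + 1)) := fun k => by
    refine le_trans ?_ (mul_le_mul_of_nonneg_left (hrdec k) hA0.le)
    have h1 : A * (a * d (k + n) ^ 2 + (X k ^ (-ℓ)) ^ 2) =
        2 * d (k + n) ^ 2 + 2 * (X k ^ (-ℓ)) ^ 2 +
          (2 * a * d (k + n) ^ 2 + 2 / a * (X k ^ (-ℓ)) ^ 2) := by
      rw [hA]; field_simp; ring
    have h2 : 0 ≤ 2 * a * d (k + n) ^ 2 + 2 / a * (X k ^ (-ℓ)) ^ 2 := by positivity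
    rw [h1]
    simp only [hs]
    nlinarith [sq_nonneg (d (k + n) - X k ^ (-ℓ))]
  set B := c + D ^ θ with hB
  have hB0 : 0 < B := by positivity
  have hskl : ∀ k, r (k + 1) ^ θ ≤ B * s k := fun k => by
    have h1 := hN₀ (k + n) (by omega)
    have e : k + 1 + n = k + n + 1 := by ring
    have hpow : 0 ≤ D * X (k + 1) ^ (-(2 * ℓ - 1)) :=
      mul_nonneg hD.le (Real.rpow_nonneg (hX0 _).le _)
    have h2 : r (k + 1) ≤ |φ (k + n + 1) - Fl| + D * X (k + 1) ^ (-(2 * ℓ - 1)) := by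
      simp only [hr, e]; gcongr; exact le_abs_self _
    -- This is where θ ≥ ℓ/(2ℓ-1) is decisive: the correction term raised to θ is at most of order
    -- X^(-ℓ).
    have h3 : (D * X (k + 1) ^ (-(2 * ℓ - 1))) ^ θ ≤ D ^ θ * X k ^ (-ℓ) := by
      rw [Real.mul_rpow hD.le (Real.rpow_nonneg (hX0 _).le _), ← Real.rpow_mul (hX0 _).le]
      gcongr
      calc X (k + 1) ^ (-(2 * ℓ - 1) * θ) ≤ X (k + 1) ^ (-ℓ) :=
            Real.rpow_le_rpow_of_exponent_le (hX1 _) (by linarith)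
        _ ≤ X k ^ (-ℓ) :=
            Real.rpow_le_rpow_of_nonpos (hX0 k) (by rw [hXs]; linarith) (by linarith)
    have h4 : X k ^ (-ℓ) ≤ s k := by simp only [hs]; linarith [hd (k + n)]
    calc r (k + 1) ^ θ ≤ (|φ (k + n + 1) - Fl| + D * X (k + 1) ^ (-(2 * ℓ - 1))) ^ θ :=
          Real.rpow_le_rpow (hr0 _) h2 hθ0.le
      _ ≤ |φ (k + n + 1) - Fl| ^ θ + (D * X (k + 1) ^ (-(2 * ℓ - 1))) ^ θ :=
          Real.rpow_add_le_add_rpow (abs_nonneg _) hpow hθ0.le hθ1.le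
      _ ≤ c * s k + D ^ θ * s k := by
          refine add_le_add h1 (h3.trans ?_)
          gcongr
      _ = _ := by rw [hB]; ring
  have hsum := (summable_of_rpow_succ_le hθ0 hθ1 hA0 hB0 hspos hr0 hsdec hskl).1
  obtain ⟨C, hC, htail⟩ :=
    tsum_tail_le_of_rpow_succ_le hθhalf hθ1 hA0 hB0 hspos hr0 hsdec hskl
  have hds : ∀ k, d (k + n) ≤ s k := fun k => by
    have := Real.rpow_pos_of_pos (hX0 k) (-ℓ)
    simp only [hs]; linarith
  have hdsum : Summable fun k => d (k + n) :=
    Summable.of_nonneg_of_le (fun k => hd _) hds hsum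
  refine ⟨(summable_nat_add_iff n).1 hdsum, ?_⟩
  set q := (1 - θ) / (2 * θ - 1) with hqdef
  have hq0 : 0 < q := div_pos (by linarith) (by linarith)
  -- The factor undoes the index shift, through k + 1 + n ≤ (n + 1)(k + 1).
  refine IsBigO.of_bound (C * ((n : ℝ) + 1) ^ q) ?_
  filter_upwards [eventually_ge_atTop (n + 1)] with K hK
  obtain ⟨k, rfl⟩ : ∃ k, K = k + 1 + n := ⟨K - (n + 1), by omega⟩
  have hnn : 0 ≤ ∑' j, d (j + (k + 1 + n)) := tsum_nonneg fun j => hd _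
  rw [Real.norm_of_nonneg hnn, Real.norm_of_nonneg (by positivity)]
  have h1 : ∑' j, d (j + (k + 1 + n)) ≤ ∑' j, s (j + (k + 1)) := by
    refine Summable.tsum_le_tsum (fun j => ?_) ?_ ((summable_nat_add_iff (k + 1)).2 hsum)
    · rw [← add_assoc j]; exact hds _
    · simpa only [add_assoc] using (summable_nat_add_iff (k + 1)).2 hdsum
  refine h1.trans ((htail k).trans ?_)
  rw [mul_assoc]
  gcongr
  have hk0 : (0 : ℝ) ≤ k := k.cast_nonneg
  have hn0 : (0 : ℝ) ≤ n := n.cast_nonneg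
  have h2 : (((n : ℝ) + 1) * ((k : ℝ) + 1)) ^ (-q) ≤ ((k + 1 + n : ℕ) : ℝ) ^ (-q) := by
    refine Real.rpow_le_rpow_of_nonpos (by positivity) ?_ (by linarith)
    push_cast; nlinarith
  rw [Real.mul_rpow (by positivity) (by positivity), Real.rpow_neg (by positivity)] at h2
  have h3 : (0 : ℝ) < ((n : ℝ) + 1) ^ q := by positivity
  calc ((k : ℝ) + 1) ^ (-q)
      = ((n : ℝ) + 1) ^ q * ((((n : ℝ) + 1) ^ q)⁻¹ * ((k : ℝ) + 1) ^ (-q)) := by field_simp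
    _ ≤ _ := by gcongr

end RealSequences

/-! ### The Łojasiewicz inequality and subgradients in real-valued form. -/

section KL

variable {E : Type*} [NormedAddCommGroup E] [InnerProductSpace ℝ E]
  {G : E → EReal} {f : E → ℝ} {S : Set E}

/-- Close to x the gap is below 1, so a larger exponent only weakens the inequality. Requiring ϑ > 0
makes real powers agree with the convention at gap zero. -/
theorem IsLojasiewiczExponent.eventually_rpow_le (hG : ∀ y ∈ S, G y = f y) {x : E} (hx : x ∈ S)
    (hf : ContinuousAt f x) {θ ϑ : ℝ} (h : IsLojasiewiczExponent G x θ) (hθϑ : θ ≤ ϑ)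
    (hϑ : 0 < ϑ) :
    ∃ c > 0, ∀ᶠ y in 𝓝 x, y ∈ S → ∀ ξ ∈ frechetSubdiff G y, |f y - f x| ^ ϑ ≤ c * ‖ξ‖ := by
  obtain ⟨hθ0, -, c, hc, η, hη, hle⟩ := h
  refine ⟨c, hc, ?_⟩
  have hnear : ∀ᶠ y in 𝓝 x, |f y - f x| < 1 := by
    have := Metric.tendsto_nhds.1 hf 1 one_pos
    simpa [Real.dist_eq] using this
  filter_upwards [Metric.closedBall_mem_nhds x hη, hnear] with y hy hy1 hyS ξ hξ
  by_cases hfe : f y = f x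
  · rw [hfe, sub_self, abs_zero, Real.zero_rpow hϑ.ne']; positivity
  have ht : 0 < |f y - f x| := abs_pos.2 (sub_ne_zero.2 hfe)
  have h1 := hle y hy
  rw [if_neg (by rw [hG y hyS, hG x hx]; exact_mod_cast hfe), hG y hyS, hG x hx,
    ← EReal.coe_sub, EReal.abs_def, ENNReal.ofReal_rpow_of_pos ht] at h1
  have h2 : Metric.infEDist (0 : E) (frechetSubdiff G y) ≤ ENNReal.ofReal ‖ξ‖ := by
    refine (Metric.infEDist_le_edist_of_mem hξ).trans ?_
    rw [edist_dist, dist_zero_left]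
  have h3 := h1.trans (mul_le_mul_right h2 _)
  rw [← ENNReal.ofReal_mul hc.le, ENNReal.ofReal_le_ofReal_iff (by positivity)] at h3
  exact (Real.rpow_le_rpow_of_exponent_ge ht hy1.le hθϑ).trans h3

variable [CompleteSpace E]

/-- Gradient plus a normal vector is a Fréchet subgradient: the first-order error of f is o(‖y -
x‖), and points outside S impose no condition. -/
theorem mem_frechetSubdiff_of_normal (hG : ∀ y ∈ S, G y = f y) (hGtop : ∀ y ∉ S, G y = ⊤)
    {x ξ : E} (hx : x ∈ S) (hf : DifferentiableAt ℝ f x)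
    (hn : ∀ y ∈ S, inner ℝ (ξ - gradient f x) (y - x) ≤ 0) : ξ ∈ frechetSubdiff G x := by
  refine ⟨by rw [hG x hx]; exact EReal.coe_lt_top _, fun ε hε => ?_⟩
  have h1 := hf.hasGradientAt.hasFDerivAt.isLittleO
  filter_upwards [h1.bound hε] with y hy
  by_cases hyS : y ∈ S
  · rw [hG x hx, hG y hyS, ← EReal.coe_add, EReal.coe_le_coe_iff]
    have h2 := hn y hyS
    rw [inner_sub_left] at h2
    simp only [InnerProductSpace.toDual_apply_apply] at hy
    rw [Real.norm_eq_abs] at hy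
    have h3 := (abs_le.1 hy).1
    linarith
  · rw [hGtop y hyS]; exact le_top

end KL

/-! ### Convergence and rates in an abstract compact feasible set. -/

section KLConvergence

variable {E : Type*} [NormedAddCommGroup E] [InnerProductSpace ℝ E]
  {G : E → EReal} {f : E → ℝ} {S : Set E}

/-- Uniformization of the Łojasiewicz inequality along a sequence in a compact set. -/
theorem exists_eventually_rpow_le (hS : IsCompact S) (hG : ∀ y ∈ S, G y = f y)
    (hf : Continuous f) {y ξ : ℕ → E} (hy : ∀ᶠ k in atTop, y k ∈ S)
    (hξ : ∀ᶠ k in atTop, ξ k ∈ frechetSubdiff G (y k)) {Fl : ℝ}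
    (hlim : Tendsto (fun k => f (y k)) atTop (𝓝 Fl))
    (hKL : ∀ x ∈ S, MapClusterPt x atTop y → HasLojasiewiczProperty G x)
    {θ₀ : ℝ} (hθ₀ : 0 < θ₀) (hθ₁ : θ₀ < 1) :
    ∃ θ, θ₀ ≤ θ ∧ θ < 1 ∧ ∃ c > 0, ∀ᶠ k in atTop, |f (y k) - Fl| ^ θ ≤ c * ‖ξ k‖ := by
  have hnear : ∀ᶠ k in atTop, |f (y k) - Fl| < 1 := by
    have := Metric.tendsto_nhds.1 hlim 1 one_pos
    simpa [Real.dist_eq] using this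
  have hup : ∀ {k : ℕ} {θ θ' c c' : ℝ}, |f (y k) - Fl| < 1 → 0 < θ → θ ≤ θ' → c ≤ c' →
      |f (y k) - Fl| ^ θ ≤ c * ‖ξ k‖ → |f (y k) - Fl| ^ θ' ≤ c' * ‖ξ k‖ := by
    intro k θ θ' c c' h1 hθ hθθ' hcc' h
    refine le_trans ?_ (h.trans (mul_le_mul_of_nonneg_right hcc' (norm_nonneg _)))
    rcases (abs_nonneg (f (y k) - Fl)).eq_or_lt with h0 | h0
    · rw [← h0, Real.zero_rpow (by linarith), Real.zero_rpow hθ.ne']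
    · exact Real.rpow_le_rpow_of_exponent_ge h0 h1.le hθθ'
  have hcov : ∃ θ, θ₀ ≤ θ ∧ θ < 1 ∧ ∃ c > 0, ∀ᶠ k in atTop, y k ∈ S →
      |f (y k) - Fl| ^ θ ≤ c * ‖ξ k‖ := by
    -- Compactness merges finitely many local inequalities by taking maxima of exponents and
    -- constants. At a cluster point f equals Fl; any other point has a neighbourhood the sequence
    -- eventually leaves, where the claim is vacuous.
    refine hS.induction_on (p := fun T => ∃ θ, θ₀ ≤ θ ∧ θ < 1 ∧ ∃ c > 0, ∀ᶠ k in atTop, y k ∈ T →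
      |f (y k) - Fl| ^ θ ≤ c * ‖ξ k‖) ?_ ?_ ?_ ?_
    · exact ⟨θ₀, le_rfl, hθ₁, 1, one_pos, Eventually.of_forall fun k hk => hk.elim⟩
    · rintro T T' hTT' ⟨θ, h1, h2, c, hc, h⟩
      exact ⟨θ, h1, h2, c, hc, h.mono fun k hk hkT => hk (hTT' hkT)⟩
    · rintro T T' ⟨θ, h1, h2, c, hc, h⟩ ⟨θ', h1', h2', c', hc', h'⟩
      refine ⟨max θ θ', h1.trans (le_max_left _ _), max_lt h2 h2', max c c',
        lt_max_of_lt_left hc, ?_⟩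
      filter_upwards [h, h', hnear] with k hk hk' hk1 hkT
      rcases hkT with hkT | hkT
      · exact hup hk1 (by linarith) (le_max_left _ _) (le_max_left _ _) (hk hkT)
      · exact hup hk1 (by linarith) (le_max_right _ _) (le_max_right _ _) (hk' hkT)
    · intro x hx
      by_cases hcl : MapClusterPt x atTop y
      · obtain ⟨θ, hθ⟩ := hKL x hx hcl
        have hθ1 : θ < 1 := hθ.2.1
        obtain ⟨u, hu, hux⟩ := hcl.tendsto_subseq
        have hFx : f x = Fl :=
          tendsto_nhds_unique ((hf.tendsto x).comp hux) (hlim.comp hu.tendsto_atTop)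
        obtain ⟨c, hc, h⟩ := hθ.eventually_rpow_le hG hx hf.continuousAt (le_max_left θ θ₀)
          (lt_max_of_lt_right hθ₀)
        rw [hFx] at h
        refine ⟨_, mem_nhdsWithin_of_mem_nhds h, max θ θ₀, le_max_right _ _, max_lt hθ1 hθ₁, c, hc,
          ?_⟩
        filter_upwards [hy, hξ] with k hkS hkξ hk
        exact hk hkS _ hkξ
      · rw [mapClusterPt_iff_frequently] at hcl
        push Not at hcl
        obtain ⟨T, hT, h⟩ := hcl
        exact ⟨T, mem_nhdsWithin_of_mem_nhds hT, θ₀, le_rfl, hθ₁, 1, one_pos,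
          h.mono fun k hk hkT => (hk hkT).elim⟩
  obtain ⟨θ, h1, h2, c, hc, h⟩ := hcov
  exact ⟨θ, h1, h2, c, hc, by filter_upwards [h, hy] with k hk hkS using hk hkS⟩

variable [CompleteSpace E]

/-- A cluster point of a sequence with vanishing relative gradients is stationary. -/
theorem isStationaryPt_of_mapClusterPt (hG : ∀ y ∈ S, G y = f y) (hGtop : ∀ y ∉ S, G y = ⊤)
    (hf : Differentiable ℝ f) (hgrad : ContinuousOn (gradient f) S)
    {y ξ : ℕ → E} (hy : ∀ᶠ k in atTop, y k ∈ S) (hξ : Tendsto ξ atTop (𝓝 0))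
    (hn : ∀ᶠ k in atTop, ∀ x ∈ S, inner ℝ (ξ k - gradient f (y k)) (x - y k) ≤ 0)
    {x : E} (hx : x ∈ S) (hcl : MapClusterPt x atTop y) : IsStationaryPt G x := by
  refine mem_frechetSubdiff_of_normal hG hGtop hx (hf x) fun w hw => ?_
  obtain ⟨u, hu, hux⟩ := hcl.tendsto_subseq
  have hyS : ∀ᶠ k in atTop, y (u k) ∈ S := hu.tendsto_atTop.eventually hy
  have hgr : Tendsto (fun k => gradient f (y (u k))) atTop (𝓝 (gradient f x)) :=
    (hgrad x hx).tendsto.comp (tendsto_nhdsWithin_iff.2 ⟨hux, hyS⟩)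
  have hlim : Tendsto (fun k => inner ℝ (ξ (u k) - gradient f (y (u k))) (w - y (u k))) atTop
      (𝓝 (inner ℝ (0 - gradient f x) (w - x))) :=
    ((hξ.comp hu.tendsto_atTop).sub hgr).inner (hux.const_sub w)
  exact le_of_tendsto hlim ((hu.tendsto_atTop.eventually hn).mono fun k hk => hk w hw)

/-- Convergence with rates of a perturbed descent sequence under the Łojasiewicz property. -/
theorem tendsto_and_isBigO_of_lojasiewicz (hS : IsCompact S) (hG : ∀ y ∈ S, G y = f y)
    (hGtop : ∀ y ∉ S, G y = ⊤) (hf : Differentiable ℝ f) (hgrad : ContinuousOn (gradient f) S)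
    (hKL : ∀ x, IsStationaryPt G x → HasLojasiewiczProperty G x)
    {y : ℕ → E} {N : ℕ} {a b C ℓ : ℝ} (ha : 0 < a) (hb : 0 ≤ b) (hC : 0 < C) (hℓ : 1 < ℓ)
    (hy : ∀ k ≥ N, y k ∈ S)
    (hdec : ∀ k ≥ N, f (y (k + 1)) + a * ‖y (k + 1) - y k‖ ^ 2 ≤
      f (y k) + b * ((k : ℝ) ^ (-ℓ)) ^ 2)
    (hsub : ∀ k ≥ N, ∃ ξ, ‖ξ‖ ≤ C * (‖y (k + 1) - y k‖ + (k : ℝ) ^ (-ℓ)) ∧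
      ∀ x ∈ S, inner ℝ (ξ - gradient f (y (k + 1))) (x - y (k + 1)) ≤ 0) :
    ∃ x ∈ S, Tendsto y atTop (𝓝 x) ∧ IsStationaryPt G x ∧
      ∀ θ, IsLojasiewiczExponent G x θ → ∀ ϑ, θ ≤ ϑ → ℓ / (2 * ℓ - 1) ≤ ϑ → ϑ < 1 →
        (fun k => ‖y k - x‖) =O[atTop] fun k : ℕ => (k : ℝ) ^ (-((1 - ϑ) / (2 * ϑ - 1))) := by
  set d : ℕ → ℝ := fun k => ‖y (k + 1) - y k‖ with hd
  have hd0 : ∀ k, 0 ≤ d k := fun k => norm_nonneg _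
  obtain ⟨Fl, hFl⟩ : ∃ Fl, Tendsto (fun k => f (y k)) atTop (𝓝 Fl) := by
    refine exists_tendsto_of_perturbed_descent (d := d) ha hb hℓ hdec ?_
    obtain ⟨m, hm⟩ := (hS.image hf.continuous).bddBelow
    exact ⟨m, fun k hk => hm ⟨_, hy k hk, rfl⟩⟩
  have hd_lim : Tendsto d atTop (𝓝 0) := tendsto_zero_of_perturbed_descent ha hℓ hd0 hdec hFl
  choose! ξ hξ hξn using hsub
  set y' : ℕ → E := fun k => y (k + 1) with hy'
  have hy'S : ∀ᶠ k in atTop, y' k ∈ S :=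
    eventually_atTop.2 ⟨N, fun k hk => hy (k + 1) (by omega)⟩
  have hξ0 : Tendsto ξ atTop (𝓝 0) := by
    rw [tendsto_zero_iff_norm_tendsto_zero]
    have h1 := (hd_lim.add (tendsto_nat_rpow_neg (show 0 < ℓ by linarith))).const_mul C
    rw [add_zero, mul_zero] at h1
    exact squeeze_zero' (Eventually.of_forall fun k => norm_nonneg _)
      (eventually_atTop.2 ⟨N, hξ⟩) h1
  have hξn' : ∀ᶠ k in atTop, ∀ x ∈ S, inner ℝ (ξ k - gradient f (y' k)) (x - y' k) ≤ 0 :=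
    eventually_atTop.2 ⟨N, hξn⟩
  have hξF : ∀ᶠ k in atTop, ξ k ∈ frechetSubdiff G (y' k) := by
    filter_upwards [hy'S, hξn'] with k h1 h2
    exact mem_frechetSubdiff_of_normal hG hGtop h1 (hf _) h2
  have hFl' : Tendsto (fun k => f (y' k)) atTop (𝓝 Fl) := (tendsto_add_atTop_iff_nat 1).2 hFl
  have hstat : ∀ x ∈ S, MapClusterPt x atTop y' → IsStationaryPt G x := fun x hx hcl =>
    isStationaryPt_of_mapClusterPt hG hGtop hf hgrad hy'S hξ0 hξn' hx hcl
  have hlen : ∀ {θ c : ℝ}, ℓ / (2 * ℓ - 1) ≤ θ → θ < 1 → 0 < c →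
      (∀ᶠ k in atTop, |f (y' k) - Fl| ^ θ ≤ c * ‖ξ k‖) →
      Summable d ∧ (fun k => ∑' j, d (j + k)) =O[atTop]
        fun k : ℕ => (k : ℝ) ^ (-((1 - θ) / (2 * θ - 1))) := by
    intro θ c hθ hθ1 hc h
    refine summable_and_isBigO_of_perturbed_descent ha hb hℓ hd0 hdec hFl hθ hθ1
      (mul_pos hc hC) ?_
    filter_upwards [h, eventually_ge_atTop N] with k hk hkN
    refine hk.trans ?_
    rw [mul_assoc]
    exact mul_le_mul_of_nonneg_left (hξ k hkN) hc.le
  have hq : 0 < 2 * ℓ - 1 := by linarith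
  have hθ₀ : 0 < ℓ / (2 * ℓ - 1) := div_pos (by linarith) hq
  have hθ₁ : ℓ / (2 * ℓ - 1) < 1 := by rw [div_lt_one hq]; linarith
  -- The limit is not yet known to exist, so a uniform exponent over all cluster points is used to
  -- obtain finite length; the exponent at the limit itself serves afterwards for the rate.
  obtain ⟨θ, hθ, hθ1, c, hc, hle⟩ := exists_eventually_rpow_le hS hG hf.continuous hy'S hξF hFl'
    (fun x hx hcl => hKL x (hstat x hx hcl)) hθ₀ hθ₁
  have hsum := (hlen hθ hθ1 hc hle).1
  have hdist : ∀ k, dist (y k) (y k.succ) = d k := fun k => by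
    rw [dist_comm, dist_eq_norm]
  obtain ⟨x, hx⟩ := cauchySeq_tendsto_of_complete
    (cauchySeq_of_summable_dist (f := y) (by simpa only [hdist] using hsum))
  have hx' : Tendsto y' atTop (𝓝 x) := (tendsto_add_atTop_iff_nat 1).2 hx
  have hxS : x ∈ S := hS.isClosed.mem_of_tendsto hx' hy'S
  have hFx : f x = Fl := tendsto_nhds_unique ((hf.continuous.tendsto x).comp hx) hFl
  refine ⟨x, hxS, hx, hstat x hxS hx'.mapClusterPt, fun θ hθ ϑ hθϑ hϑ hϑ1 => ?_⟩
  obtain ⟨c, hc, h⟩ := hθ.eventually_rpow_le hG hxS hf.continuous.continuousAt hθϑ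
    (hθ₀.trans_le hϑ)
  rw [hFx] at h
  have hev : ∀ᶠ k in atTop, |f (y' k) - Fl| ^ ϑ ≤ c * ‖ξ k‖ := by
    filter_upwards [hx'.eventually h, hy'S, hξF] with k h1 h2 h3 using h1 h2 _ h3
  refine IsBigO.trans (IsBigO.of_bound 1 (Eventually.of_forall fun k => ?_))
    (hlen hϑ hϑ1 hc hev).2
  rw [norm_norm, one_mul, Real.norm_of_nonneg (tsum_nonneg fun j => hd0 _), ← dist_eq_norm]
  simpa only [add_comm] using
    dist_le_tsum_of_dist_le_of_tendsto d (fun k => (hdist k).le) hsum hx k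

end KLConvergence

/-! ### Norm comparisons and convex sublevel sets. -/

theorem PiLp.norm_le_sum_norm {ι : Type*} [Fintype ι] {β : ι → Type*}
    [∀ i, SeminormedAddCommGroup (β i)] (x : PiLp 2 β) : ‖x‖ ≤ ∑ i, ‖x i‖ := by
  rw [PiLp.norm_eq_of_L2]
  exact Real.sqrt_le_iff.2 ⟨Finset.sum_nonneg fun i _ => norm_nonneg _,
    Finset.sum_sq_le_sq_sum_of_nonneg fun i _ => norm_nonneg _⟩

theorem EuclideanSpace.norm_le_mul_norm_ofLp {d : ℕ} (x : EuclideanSpace ℝ (Fin d)) :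
    ‖x‖ ≤ d * ‖(WithLp.ofLp x : Fin d → ℝ)‖ := by
  refine (PiLp.norm_le_sum_norm x).trans ?_
  calc ∑ i, ‖x i‖ ≤ ∑ _i : Fin d, ‖(WithLp.ofLp x : Fin d → ℝ)‖ :=
        Finset.sum_le_sum fun i _ => norm_le_pi_norm (WithLp.ofLp x) i
    _ = _ := by simp

section Convex

variable {X : Type*} [NormedAddCommGroup X] [InnerProductSpace ℝ X]

theorem ConvexOn.add_inner_gradient_le [CompleteSpace X] {g : X → ℝ} (hg : ConvexOn ℝ univ g)
    {x : X} (hd : DifferentiableAt ℝ g x) (y : X) :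
    g x + inner ℝ (gradient g x) (y - x) ≤ g y := by
  have hc : ConvexOn ℝ univ (g ∘ AffineMap.lineMap (k := ℝ) x y) := by
    simpa using hg.comp_affineMap (AffineMap.lineMap (k := ℝ) x y)
  have hder : HasDerivAt (g ∘ AffineMap.lineMap (k := ℝ) x y)
      (inner ℝ (gradient g x) (y - x)) 0 := by
    have h1 : HasFDerivAt g (InnerProductSpace.toDual ℝ X (gradient g x))
        (AffineMap.lineMap (k := ℝ) x y 0) := by
      rw [AffineMap.lineMap_apply_zero]; exact hd.hasGradientAt.hasFDerivAt
    have h2 := h1.comp_hasDerivAt (0 : ℝ) AffineMap.hasDerivAt_lineMap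
    rwa [InnerProductSpace.toDual_apply_apply] at h2
  have h := hc.le_slope_of_hasDerivAt (mem_univ 0) (mem_univ 1) one_pos hder
  simp only [slope_def_field, Function.comp_apply, AffineMap.lineMap_apply_one,
    AffineMap.lineMap_apply_zero, sub_zero, div_one] at h
  linarith

/-- Small sublevel sets of convex functions are close to the zero sublevel set, if compact. -/
theorem exists_forall_le_imp_mem_cthickening [FiniteDimensional ℝ X] {ι : Type*} [Fintype ι]
    {h : X → ι → ℝ} (hconv : ∀ j, ConvexOn ℝ univ fun x => h x j)
    (hcont : ∀ j, Continuous fun x => h x j) {S : Set X} (hS : S = {x | ∀ j, h x j ≤ 0})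
    (hne : S.Nonempty) (hcomp : IsCompact S) {ε : ℝ} (hε : 0 < ε) :
    ∃ δ > 0, ∀ x, (∀ j, h x j ≤ δ) → x ∈ Metric.cthickening ε S := by
  have hin : ∀ x, Metric.infDist x S ≤ ε → x ∈ Metric.cthickening ε S := fun x hx => by
    obtain ⟨s, hs, hxs⟩ := hcomp.exists_infDist_eq_dist hne x
    exact Metric.mem_cthickening_of_dist_le x s ε S hs (hxs ▸ hx)
  set Q : Set X := {x | Metric.infDist x S = ε} with hQ
  set H : X → ℝ := fun x => ∑ j, max (h x j) 0 with hH
  have hHcont : Continuous H := continuous_finsetSum _ fun j _ => (hcont j).max continuous_const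
  have hQcomp : IsCompact Q := by
    have : FiniteDimensional ℝ X := inferInstance
    have : ProperSpace X := FiniteDimensional.proper ℝ X
    refine (hcomp.cthickening (r := ε)).of_isClosed_subset ?_ fun x hx => hin x (le_of_eq hx)
    exact isClosed_eq (Metric.continuous_infDist_pt S) continuous_const
  have hpos : ∀ x ∈ Q, 0 < H x := fun x hx => by
    by_contra! hle
    have h0 : ∀ j, h x j ≤ 0 := fun j => by
      have h1 : max (h x j) 0 ≤ H x :=
        Finset.single_le_sum (f := fun j => max (h x j) 0) (fun i _ => le_max_right _ _)
          (Finset.mem_univ j)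
      exact (le_max_left _ _).trans (h1.trans hle)
    have hxS : x ∈ S := by rw [hS]; exact h0
    have : Metric.infDist x S = 0 := Metric.infDist_zero_of_mem hxS
    rw [hQ, mem_ofPred_eq] at hx
    linarith
  obtain ⟨m, hm, hmH⟩ : ∃ m > 0, ∀ x ∈ Q, m ≤ H x := by
    rcases Q.eq_empty_or_nonempty with hQe | hQne
    · exact ⟨1, one_pos, by simp [hQe]⟩
    · obtain ⟨x, hx, hmin⟩ := hQcomp.exists_isMinOn hQne hHcont.continuousOn
      exact ⟨H x, hpos x hx, fun y hy => hmin hy⟩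
  -- If x lay farther than ε from S, the segment from a point of S to x would cross the level set Q.
  -- Convexity keeps each constraint at most δ there, so H ≤ card ι · δ < m, contradicting the
  -- minimum of H on Q.
  set δ := m / (Fintype.card ι + 1) with hδ
  have hδ0 : 0 < δ := by positivity
  refine ⟨δ, hδ0, fun x hx => ?_⟩
  by_contra hnot
  have hfar : ε < Metric.infDist x S := not_le.1 fun hle => hnot (hin x hle)
  obtain ⟨s, hs⟩ := hne
  have hg : ContinuousOn (fun t : ℝ => Metric.infDist (AffineMap.lineMap s x t) S) (Icc 0 1) :=
    ((Metric.continuous_infDist_pt S).comp AffineMap.lineMap_continuous).continuousOn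
  obtain ⟨t, ht, hteq⟩ := intermediate_value_Icc zero_le_one hg
    (show ε ∈ Icc _ _ by
      rw [AffineMap.lineMap_apply_zero, AffineMap.lineMap_apply_one,
        Metric.infDist_zero_of_mem hs]
      exact ⟨hε.le, hfar.le⟩)
  have h1 := hmH _ hteq
  have h2 : ∀ j, h (AffineMap.lineMap s x t) j ≤ δ := fun j => by
    rw [AffineMap.lineMap_apply_module]
    have h3 := (hconv j).2 (mem_univ s) (mem_univ x) (sub_nonneg.2 ht.2) ht.1 (by ring)
    rw [hS] at hs
    have h4 := hs j
    have h5 := hx j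
    simp only [smul_eq_mul] at h3
    nlinarith [ht.1, ht.2, mul_nonneg (sub_nonneg.2 ht.2) hδ0.le,
      mul_nonneg ht.1 (sub_nonneg.2 h5), mul_nonneg (sub_nonneg.2 ht.2) (neg_nonneg.2 h4)]
  have h6 : H (AffineMap.lineMap s x t) ≤ Fintype.card ι * δ := by
    calc _ ≤ ∑ _j : ι, δ := Finset.sum_le_sum fun j _ => max_le (h2 j) hδ0.le
      _ = _ := by simp
  have h7 : Fintype.card ι * δ < m := by
    rw [hδ, mul_div_assoc', div_lt_iff₀ (by positivity)]
    nlinarith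
  linarith

end Convex

/-! ### From residuals to distances from the exact projection. -/

namespace BlockProblem

variable {n : ℕ} (P : BlockProblem n)

theorem inner_jacMul_le {i : Fin n} {x y : P.Block i} {lam : Fin (P.p i) → ℝ}
    (hlam : ∀ j, 0 ≤ lam j) (hy : y ∈ P.S i) :
    inner ℝ (P.jacMul i x lam) (y - x) ≤ -∑ j, lam j * P.h i x j := by
  rw [jacMul, sum_inner, ← Finset.sum_neg_distrib]
  refine Finset.sum_le_sum fun j _ => ?_
  rw [real_inner_smul_left]
  have h1 := (P.convexOn_h i j).add_inner_gradient_le (P.differentiable_h i j x) y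
  have h2 := hy j
  nlinarith [hlam j]

theorem max_constraint_le_residual (i : Fin n) (x : P.Block i) (lam : Fin (P.p i) → ℝ)
    (xt : P.Block i) :
    ‖(fun j => max (P.h i x j) 0 : Fin (P.p i) → ℝ)‖ ≤ P.residual i x lam xt := by
  have h1 := le_max_right (inner ℝ x (x - xt + P.jacMul i x lam)) 0
  have h2 := le_max_right (-∑ j, lam j * P.h i x j) 0
  have h3 := norm_nonneg (WithLp.ofLp (x - xt + P.jacMul i x lam) : Fin (P.m i) → ℝ)
  rw [residual]
  linarith

/-- The residual bounds the squared distance of an approximate projection to the projection. -/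
theorem sq_norm_sub_le_residual {i : Fin n} {x xb xt : P.Block i} {lam : Fin (P.p i) → ℝ}
    (hlam : ∀ j, 0 ≤ lam j) (hne : (P.S i).Nonempty) (hcomp : IsCompact (P.S i))
    (hxb : xb ∈ P.S i) (hmin : ∀ y ∈ P.S i, ‖xb - xt‖ ≤ ‖y - xt‖) {R c : ℝ} (hR : 0 ≤ R)
    (hc : 0 ≤ c) (hxR : ‖x‖ ≤ R) (hxbR : ‖xb‖ ≤ R) (hxtR : ‖xt‖ ≤ R)
    (hhoff : Metric.infDist x (P.S i) ≤ c * ‖(WithLp.toLp 2 fun j => max (P.h i x j) 0 :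
      EuclideanSpace ℝ (Fin (P.p i)))‖) :
    ‖xb - x‖ ^ 2 ≤ (4 * R * c * P.p i + 2 * P.m i * R + 4) * P.residual i x lam xt := by
  set e := x - xt + P.jacMul i x lam with he
  set ρ := P.residual i x lam xt with hρ
  have hρh := P.max_constraint_le_residual i x lam xt
  have a1 := le_max_right (inner ℝ x e) 0
  have a2 := le_max_right (-∑ j, lam j * P.h i x j) 0
  have a3 := norm_nonneg (WithLp.ofLp e : Fin (P.m i) → ℝ)
  have a4 := norm_nonneg (fun j => max (P.h i x j) 0 : Fin (P.p i) → ℝ)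
  have a5 := le_max_left (inner ℝ x e) 0
  have a6 := le_max_left (-∑ j, lam j * P.h i x j) 0
  have hρ' : ρ = max (inner ℝ x e) 0 + ‖(WithLp.ofLp e : Fin (P.m i) → ℝ)‖
    + ‖(fun j => max (P.h i x j) 0 : Fin (P.p i) → ℝ)‖
    + max (-∑ j, lam j * P.h i x j) 0 := rfl
  have hρ0 : 0 ≤ ρ := by linarith
  have hxe : inner ℝ x e ≤ ρ := by linarith
  have hlh : -∑ j, lam j * P.h i x j ≤ ρ := by linarith
  have he_norm : ‖e‖ ≤ P.m i * ρ :=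
    (EuclideanSpace.norm_le_mul_norm_ofLp e).trans (by gcongr; linarith)
  have hdist : Metric.infDist x (P.S i) ≤ c * (P.p i * ρ) :=
    hhoff.trans (by
      gcongr
      exact (EuclideanSpace.norm_le_mul_norm_ofLp _).trans (by gcongr))
  obtain ⟨s, hs, hxs⟩ := hcomp.exists_infDist_eq_dist hne x
  -- Since x may be infeasible, the minimality of xb is tested against the nearest feasible point,
  -- which the Hoffman bound puts close to x.
  have h1 : ‖xb - xt‖ ≤ ‖x - xt‖ + c * (P.p i * ρ) := by
    refine (hmin s hs).trans ?_
    have h2 : s - xt = (s - x) + (x - xt) := by abel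
    rw [hxs, dist_comm, dist_eq_norm] at hdist
    rw [h2]
    linarith [norm_add_le (s - x) (x - xt)]
  have hb1 : ‖xb - xt‖ ≤ 2 * R := by linarith [norm_sub_le xb xt]
  have hb2 : ‖x - xt‖ ≤ 2 * R := by linarith [norm_sub_le x xt]
  have hsq : ‖xb - xt‖ ^ 2 - ‖x - xt‖ ^ 2 ≤ 4 * R * (c * (P.p i * ρ)) := by
    have h3 : 0 ≤ c * (P.p i * ρ) := by positivity
    have h4 := mul_le_mul_of_nonneg_right (sub_le_iff_le_add'.2 h1)
      (add_nonneg (norm_nonneg (xb - xt)) (norm_nonneg (x - xt)))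
    have h5 := mul_le_mul_of_nonneg_left (add_le_add hb1 hb2) h3
    nlinarith
  have hexp : ‖xb - xt‖ ^ 2 = ‖x - xt‖ ^ 2 + 2 * inner ℝ (x - xt) (xb - x) + ‖xb - x‖ ^ 2 := by
    rw [← norm_add_sq_real]; congr 2; abel
  -- Each of the three terms is controlled by one part of the residual. The multiplier enters only
  -- through convexity and complementarity, so no bound on λ is needed.
  have hin : inner ℝ (x - xt) (xb - x) =
      inner ℝ xb e - inner ℝ x e - inner ℝ (P.jacMul i x lam) (xb - x) := by
    have h6 : x - xt = e - P.jacMul i x lam := by rw [he]; abel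
    rw [h6, inner_sub_left, inner_sub_right e, real_inner_comm e xb, real_inner_comm e x]
  have hxbe : -(R * (P.m i * ρ)) ≤ inner ℝ xb e := by
    have h7 := (abs_le.1 (abs_real_inner_le_norm xb e)).1
    have h8 : ‖xb‖ * ‖e‖ ≤ R * (P.m i * ρ) := by gcongr
    linarith
  have hjac := P.inner_jacMul_le (x := x) hlam hxb
  nlinarith

section Iterates

variable {P} {z : ℕ → P.Space} {σ : ℕ → Fin n → ℝ} {k : ℕ} {i : Fin n}

/-- Completing the square: the exact solution is the projection of the gradient step onto the
feasible block. -/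
theorem proxObjective_eq (hσ : 0 < σ k i) (x : P.Block i) :
    P.proxObjective z σ k i x = σ k i / 2 * ‖x - P.gradStep z σ k i‖ ^ 2 -
      ‖P.gradBlock i (P.mixed z k i)‖ ^ 2 / (2 * σ k i) := by
  have h1 : x - P.gradStep z σ k i =
      (x - z k i) + (1 / σ k i) • P.gradBlock i (P.mixed z k i) := by
    rw [gradStep]; abel
  rw [h1, norm_add_sq_real, norm_smul, real_inner_smul_right, real_inner_comm, proxObjective,
    Real.norm_of_nonneg (by positivity)]
  field_simp
  ring

theorem norm_exactBlock_sub_le (hne : (P.S i).Nonempty) (hcomp : IsCompact (P.S i))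
    (hσ : 0 < σ k i) {y : P.Block i} (hy : y ∈ P.S i) :
    ‖P.exactBlock z σ k i - P.gradStep z σ k i‖ ≤ ‖y - P.gradStep z σ k i‖ := by
  have h1 : P.proxObjective z σ k i (P.exactBlock z σ k i) ≤ P.proxObjective z σ k i y :=
    (P.exactBlock_spec z σ k i hne hcomp).2 hy
  rw [proxObjective_eq hσ, proxObjective_eq hσ, sub_le_sub_iff_right,
    mul_le_mul_iff_right₀ (by positivity)] at h1
  exact le_of_sq_le_sq h1 (norm_nonneg _)

theorem inner_exactBlock_nonneg (hne : (P.S i).Nonempty) (hcomp : IsCompact (P.S i))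
    (hconv : Convex ℝ (P.S i)) (hσ : 0 < σ k i) {y : P.Block i} (hy : y ∈ P.S i) :
    0 ≤ inner ℝ (P.gradBlock i (P.mixed z k i) + σ k i • (P.exactBlock z σ k i - z k i))
      (y - P.exactBlock z σ k i) := by
  set xb := P.exactBlock z σ k i with hxb
  have hxbS : xb ∈ P.S i := (P.exactBlock_spec z σ k i hne hcomp).1
  have hinf : ‖P.gradStep z σ k i - xb‖ = ⨅ w : P.S i, ‖P.gradStep z σ k i - w‖ := by
    have : Nonempty (P.S i) := ⟨⟨xb, hxbS⟩⟩
    refine le_antisymm (le_ciInf fun w => ?_)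
      (ciInf_le ⟨0, by rintro _ ⟨w, rfl⟩; exact norm_nonneg _⟩ (⟨xb, hxbS⟩ : P.S i))
    rw [norm_sub_rev, norm_sub_rev _ (w : P.Block i)]
    exact norm_exactBlock_sub_le hne hcomp hσ w.2
  have h1 := (norm_eq_iInf_iff_real_inner_le_zero hconv hxbS).1 hinf y hy
  have h2 : P.gradBlock i (P.mixed z k i) + σ k i • (xb - z k i) =
      -(σ k i • (P.gradStep z σ k i - xb)) := by
    rw [gradStep, smul_sub, smul_sub, smul_sub, smul_smul, mul_one_div_cancel hσ.ne', one_smul]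
    abel
  rw [h2, inner_neg_left, real_inner_smul_left]
  nlinarith

end Iterates

end BlockProblem

/-! ### Partially updated points and one step of the method. -/

section Hybrid

variable {n : ℕ} {m : Fin n → ℕ}

/-- The point with the first `t` blocks of `a` and the remaining blocks of `b`. -/
noncomputable def hybrid (a b : Blocks m) (t : ℕ) : Blocks m :=
  WithLp.toLp 2 fun j => if (j : ℕ) < t then a j else b j

theorem hybrid_apply (a b : Blocks m) (t : ℕ) (j : Fin n) :
    hybrid a b t j = if (j : ℕ) < t then a j else b j := rfl

theorem hybrid_zero (a b : Blocks m) : hybrid a b 0 = b := by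
  ext j : 1; simp [hybrid_apply]

theorem hybrid_self (a : Blocks m) (t : ℕ) : hybrid a a t = a := by
  ext j : 1; simp [hybrid_apply]

theorem hybrid_eq_left (a b : Blocks m) : hybrid a b n = a := by
  ext j : 1; simp [hybrid_apply]

theorem norm_hybrid_le (a b : Blocks m) (t : ℕ) : ‖hybrid a b t‖ ≤ ‖a‖ + ‖b‖ := by
  refine le_of_sq_le_sq ?_ (by positivity)
  have h1 : ‖hybrid a b t‖ ^ 2 ≤ ‖a‖ ^ 2 + ‖b‖ ^ 2 := by
    rw [PiLp.norm_sq_eq_of_L2, PiLp.norm_sq_eq_of_L2, PiLp.norm_sq_eq_of_L2,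
      ← Finset.sum_add_distrib]
    refine Finset.sum_le_sum fun j _ => ?_
    rw [hybrid_apply]
    split_ifs
    · linarith [sq_nonneg ‖b j‖]
    · linarith [sq_nonneg ‖a j‖]
  nlinarith [norm_nonneg a, norm_nonneg b]

theorem norm_hybrid_sub_hybrid_le (a b a' b' : Blocks m) (t : ℕ) :
    ‖hybrid a b t - hybrid a' b' t‖ ≤ ‖a - a'‖ + ‖b - b'‖ := by
  have h1 : hybrid a b t - hybrid a' b' t = hybrid (a - a') (b - b') t := by
    ext j : 1
    simp only [PiLp.sub_apply, hybrid_apply]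
    split_ifs <;> rfl
  rw [h1]
  exact norm_hybrid_le _ _ _

end Hybrid

namespace BlockProblem

variable {n : ℕ} {P : BlockProblem n} {εbar : ℝ} {Lip : Fin n → ℝ}

theorem mixed_eq_hybrid (z : ℕ → P.Space) (k : ℕ) (i : Fin n) :
    P.mixed z k i = hybrid (z (k + 1)) (z k) i := rfl

theorem hybrid_mem_SbarProd {a b : P.Space} (ha : a ∈ P.SbarProd εbar) (hb : b ∈ P.SbarProd εbar)
    (t : ℕ) : hybrid a b t ∈ P.SbarProd εbar := fun j => by
  rw [hybrid_apply]
  split_ifs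
  exacts [ha j, hb j]

theorem mem_SbarProd_of_mem {a : P.Space} (ha : ∀ i, a i ∈ P.S i) : a ∈ P.SbarProd εbar :=
  fun i => Metric.self_subset_cthickening _ (ha i)

theorem BlockLipschitz.norm_gradient_sub_le (hLip : P.BlockLipschitz εbar Lip) {a b : P.Space}
    (ha : a ∈ P.SbarProd εbar) (hb : b ∈ P.SbarProd εbar) :
    ‖gradient P.f a - gradient P.f b‖ ≤ (∑ i, Lip i) * ‖a - b‖ := by
  refine (PiLp.norm_le_sum_norm _).trans ?_
  rw [Finset.sum_mul]
  exact Finset.sum_le_sum fun i _ => (hLip i).2 a ha b hb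

/-- Block descent lemma. -/
theorem BlockLipschitz.f_le_of_eq_off (hLip : P.BlockLipschitz εbar Lip)
    (hconv : ∀ i, Convex ℝ (P.S i)) {a b : P.Space}
    (ha : a ∈ P.SbarProd εbar) (hb : b ∈ P.SbarProd εbar) (i : Fin n)
    (hab : ∀ j, j ≠ i → a j = b j) :
    P.f a ≤ P.f b + inner ℝ (P.gradBlock i b) (a i - b i) + Lip i / 2 * ‖a i - b i‖ ^ 2 := by
  set v : P.Space := a - b with hv
  have hvj : ∀ j, j ≠ i → v j = 0 := fun j hj => by
    rw [hv, PiLp.sub_apply, hab j hj, sub_self]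
  have hinner : ∀ w : P.Space, inner ℝ (gradient P.f w) v = inner ℝ (P.gradBlock i w) (v i) :=
    fun w => by
      rw [PiLp.inner_apply, Finset.sum_eq_single i]
      · rfl
      · intro j _ hj; rw [hvj j hj, inner_zero_right]
      · simp
  have hnorm : ‖v‖ = ‖v i‖ := by
    have h1 : ‖v‖ ^ 2 = ‖v i‖ ^ 2 := by
      rw [PiLp.norm_sq_eq_of_L2, Finset.sum_eq_single i]
      · intro j _ hj; rw [hvj j hj, norm_zero]; simp
      · simp
    exact (sq_eq_sq₀ (norm_nonneg _) (norm_nonneg _)).1 h1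
  -- The function f along the segment minus its quadratic model. The segment stays in the convex
  -- thickened set, so the Lipschitz bound makes the derivative nonpositive.
  set φ : ℝ → ℝ := fun t => P.f (b + t • v) -
    (t * inner ℝ (P.gradBlock i b) (v i) + Lip i / 2 * ‖v i‖ ^ 2 * t ^ 2) with hφ
  have hder : ∀ t, HasDerivAt φ (inner ℝ (P.gradBlock i (b + t • v)) (v i) -
      (inner ℝ (P.gradBlock i b) (v i) + Lip i * ‖v i‖ ^ 2 * t)) t := fun t => by
    have h1 := (P.differentiable_f (b + t • v)).hasGradientAt.hasFDerivAt
    have h2 : HasDerivAt (fun t : ℝ => b + t • v) v t := by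
      simpa using ((hasDerivAt_id t).smul_const v).const_add b
    have h3 := h1.comp_hasDerivAt t h2
    rw [InnerProductSpace.toDual_apply_apply, hinner] at h3
    have h4 : HasDerivAt (fun t : ℝ => t * inner ℝ (P.gradBlock i b) (v i) +
        Lip i / 2 * ‖v i‖ ^ 2 * t ^ 2)
        (1 * inner ℝ (P.gradBlock i b) (v i) + Lip i / 2 * ‖v i‖ ^ 2 * (2 * t)) t := by
      have := (hasDerivAt_pow 2 t).const_mul (Lip i / 2 * ‖v i‖ ^ 2)
      simpa using ((hasDerivAt_id t).mul_const (inner ℝ (P.gradBlock i b) (v i))).fun_add this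
    refine (h3.sub h4).congr_deriv ?_
    ring
  have hseg : ∀ t ∈ Icc (0 : ℝ) 1, b + t • v ∈ P.SbarProd εbar := fun t ht j => by
    have h1 := ((hconv j).cthickening εbar).add_smul_sub_mem (hb j) (ha j) ht
    exact h1
  have hanti : AntitoneOn φ (Icc 0 1) := by
    refine antitoneOn_of_deriv_nonpos (convex_Icc 0 1)
      (fun t _ => (hder t).continuousAt.continuousWithinAt)
      (fun t _ => (hder t).differentiableAt.differentiableWithinAt) fun t ht => ?_
    have ht' := interior_subset ht
    rw [(hder t).deriv]
    have h1 := (hLip i).2 _ (hseg t ht') b hb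
    rw [add_sub_cancel_left, norm_smul, Real.norm_of_nonneg ht'.1, hnorm] at h1
    have h2 := real_inner_le_norm (P.gradBlock i (b + t • v) - P.gradBlock i b) (v i)
    rw [inner_sub_left] at h2
    have h3 := mul_le_mul_of_nonneg_right h1 (norm_nonneg (v i))
    nlinarith
  have h1 := hanti (left_mem_Icc.2 zero_le_one) (right_mem_Icc.2 zero_le_one) zero_le_one
  have e1 : b + v = a := by rw [hv]; abel
  simp only [hφ, zero_smul, add_zero, one_smul, e1] at h1
  have e2 : v i = a i - b i := rfl
  rw [e2] at h1
  linarith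

section Step

variable {Ml μ M e : ℝ} {z : ℕ → P.Space} {σ : ℕ → Fin n → ℝ} {k : ℕ}

theorem zbar_mem (hcon : P.ConstraintAssumption εbar Ml) (hk : 1 ≤ k) (i : Fin n) :
    P.zbar z σ k i ∈ P.S i := by
  obtain ⟨k, rfl⟩ : ∃ l, k = l + 1 := ⟨k - 1, by omega⟩
  exact (P.exactBlock_spec z σ k i (hcon.nonempty i) (hcon.compact i)).1

theorem inner_zbar_nonneg (hcon : P.ConstraintAssumption εbar Ml) {i : Fin n} (hσ : 0 < σ k i)
    {y : P.Block i} (hy : y ∈ P.S i) :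
    0 ≤ inner ℝ (P.gradBlock i (P.mixed z k i) + σ k i • (P.zbar z σ (k + 1) i - z k i))
      (y - P.zbar z σ (k + 1) i) :=
  inner_exactBlock_nonneg (hcon.nonempty i) (hcon.compact i) (hcon.convex i) hσ hy

/-- The blocks are exchanged one at a time and the changes telescoped. The subproblem's gradient is
taken at the inexact iterates, which costs an error linear in e. -/
theorem f_zbar_succ_le (hLip : P.BlockLipschitz εbar Lip) (hcon : P.ConstraintAssumption εbar Ml)
    (hμ : 0 < μ) (hσμ : ∀ i, μ ≤ σ k i) (hσL : ∀ i, Lip i ≤ σ k i) (hσM : ∀ i, σ k i ≤ M)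
    (hk : 1 ≤ k) (hz : z k ∈ P.SbarProd εbar) (hz' : z (k + 1) ∈ P.SbarProd εbar)
    (he : ‖P.zbar z σ k - z k‖ ≤ e) (he' : ‖P.zbar z σ (k + 1) - z (k + 1)‖ ≤ e) :
    P.f (P.zbar z σ (k + 1)) + μ / 4 * ‖P.zbar z σ (k + 1) - P.zbar z σ k‖ ^ 2 ≤
      P.f (P.zbar z σ k) + n * (9 * M ^ 2 / μ) * e ^ 2 := by
  set x := P.zbar z σ k with hx
  set y := P.zbar z σ (k + 1) with hy
  have hxS : ∀ i, x i ∈ P.S i := zbar_mem hcon hk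
  have hyS : ∀ i, y i ∈ P.S i := zbar_mem hcon (by omega)
  have hxB : x ∈ P.SbarProd εbar := mem_SbarProd_of_mem hxS
  have hyB : y ∈ P.SbarProd εbar := mem_SbarProd_of_mem hyS
  have he0 : 0 ≤ e := (norm_nonneg _).trans he
  have hstep : ∀ i : Fin n, P.f (hybrid y x (i + 1)) - P.f (hybrid y x i) ≤
      9 * M ^ 2 / μ * e ^ 2 - μ / 4 * ‖y i - x i‖ ^ 2 := fun i => by
    have h1 := hLip.f_le_of_eq_off hcon.convex (hybrid_mem_SbarProd hyB hxB (i + 1))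
      (hybrid_mem_SbarProd hyB hxB i) i (fun j hj => by
        rw [hybrid_apply, hybrid_apply]
        have : (j : ℕ) ≠ i := fun h => hj (Fin.ext h)
        by_cases hji : (j : ℕ) < i
        · rw [if_pos hji, if_pos (by omega)]
        · rw [if_neg hji, if_neg (by omega)])
    have e1 : hybrid y x (i + 1) i = y i := by simp [hybrid_apply]
    have e2 : hybrid y x i i = x i := by simp [hybrid_apply]
    rw [e1, e2] at h1
    have h2 : ‖P.gradBlock i (hybrid y x i) - P.gradBlock i (P.mixed z k i)‖ ≤
        Lip i * (2 * e) := by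
      rw [mixed_eq_hybrid]
      refine ((hLip i).2 _ (hybrid_mem_SbarProd hyB hxB i) _
        (hybrid_mem_SbarProd hz' hz i)).trans ?_
      have := (hLip i).1
      gcongr
      linarith [norm_hybrid_sub_hybrid_le y x (z (k + 1)) (z k) i]
    have h3 := inner_zbar_nonneg (z := z) hcon (hμ.trans_le (hσμ i)) (hxS i)
    set g := P.gradBlock i (P.mixed z k i) with hg
    set G := P.gradBlock i (hybrid y x i) with hG
    have h4 : inner ℝ (g + σ k i • (y i - z k i)) (x i - y i) =
        -(inner ℝ g (y i - x i) + σ k i * (‖y i - x i‖ ^ 2 +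
          inner ℝ (x i - z k i) (y i - x i))) := by
      have h5 : y i - z k i = (y i - x i) + (x i - z k i) := by abel
      rw [← neg_sub (y i) (x i), inner_neg_right, h5, inner_add_left, real_inner_smul_left,
        inner_add_left, real_inner_self_eq_norm_sq]
    have h3' : 0 ≤ inner ℝ (g + σ k i • (y i - z k i)) (x i - y i) := h3
    rw [h4] at h3'
    have h6 : inner ℝ G (y i - x i) ≤ inner ℝ g (y i - x i) + Lip i * (2 * e) * ‖y i - x i‖ := by
      have h7 := real_inner_le_norm (G - g) (y i - x i)
      rw [inner_sub_left] at h7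
      have h8 := mul_le_mul_of_nonneg_right h2 (norm_nonneg (y i - x i))
      linarith
    have h9 : -(e * ‖y i - x i‖) ≤ inner ℝ (x i - z k i) (y i - x i) := by
      have h10 := (abs_le.1 (abs_real_inner_le_norm (x i - z k i) (y i - x i))).1
      have h11 : ‖x i - z k i‖ ≤ e := (PiLp.norm_apply_le (x - z k) i).trans he
      have h12 := mul_le_mul_of_nonneg_right h11 (norm_nonneg (y i - x i))
      linarith
    set t := ‖y i - x i‖ with ht
    have ht0 : 0 ≤ t := norm_nonneg _
    have hσ0 : 0 < σ k i := hμ.trans_le (hσμ i)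
    have hM0 : 0 < M := hσ0.trans_le (hσM i)
    have h13 := mul_le_mul_of_nonneg_left h9 hσ0.le
    have h14 : Lip i * (2 * e) * t + σ k i * (e * t) ≤ 3 * M * (e * t) := by
      have : 0 ≤ e * t := mul_nonneg he0 ht0
      nlinarith [hσL i, hσM i]
    -- Young's inequality: of the available decrease μ/2 · t², half absorbs the cross term.
    have h15 : 3 * M * (e * t) ≤ μ / 4 * t ^ 2 + 9 * M ^ 2 / μ * e ^ 2 := by
      have : μ / 4 * t ^ 2 + 9 * M ^ 2 / μ * e ^ 2 - 3 * M * (e * t) =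
          (μ * t / 2 - 3 * M * e) ^ 2 / μ := by field_simp; ring
      have : 0 ≤ (μ * t / 2 - 3 * M * e) ^ 2 / μ := by positivity
      linarith
    have h16 : (Lip i / 2 - σ k i) * t ^ 2 ≤ -(μ / 2) * t ^ 2 := by
      have := hσL i
      have := hσμ i
      exact mul_le_mul_of_nonneg_right (by linarith) (sq_nonneg t)
    linarith
  have htel : P.f y - P.f x = ∑ i : Fin n, (P.f (hybrid y x (i + 1)) - P.f (hybrid y x i)) := by
    rw [Fin.sum_univ_eq_sum_range (fun t => P.f (hybrid y x (t + 1)) - P.f (hybrid y x t)) n,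
      Finset.sum_range_sub (fun t => P.f (hybrid y x t)), hybrid_eq_left, hybrid_zero]
  have hsum : P.f y - P.f x ≤ ∑ i : Fin n,
      (9 * M ^ 2 / μ * e ^ 2 - μ / 4 * ‖y i - x i‖ ^ 2) :=
    htel.trans_le (Finset.sum_le_sum fun i _ => hstep i)
  rw [Finset.sum_sub_distrib, Finset.sum_const, Finset.card_univ, Fintype.card_fin,
    nsmul_eq_mul, ← Finset.mul_sum] at hsum
  have hn : ‖y - x‖ ^ 2 = ∑ i, ‖y i - x i‖ ^ 2 := PiLp.norm_sq_eq_of_L2 _ _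
  rw [hn]
  linarith

theorem exists_norm_le_and_normal (hLip : P.BlockLipschitz εbar Lip)
    (hcon : P.ConstraintAssumption εbar Ml) (hσ : ∀ i, 0 < σ k i) (hσL : ∀ i, Lip i ≤ σ k i)
    (hσM : ∀ i, σ k i ≤ M)
    (hz : z k ∈ P.SbarProd εbar) (hz' : z (k + 1) ∈ P.SbarProd εbar)
    (he : ‖P.zbar z σ k - z k‖ ≤ e) (he' : ‖P.zbar z σ (k + 1) - z (k + 1)‖ ≤ e) :
    ∃ ξ : P.Space, ‖ξ‖ ≤ n * (3 * M) * (‖P.zbar z σ (k + 1) - P.zbar z σ k‖ + e) ∧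
      ∀ w : P.Space, (∀ i, w i ∈ P.S i) →
        inner ℝ (ξ - gradient P.f (P.zbar z σ (k + 1))) (w - P.zbar z σ (k + 1)) ≤ 0 := by
  set x := P.zbar z σ k with hx
  set y := P.zbar z σ (k + 1) with hy
  have hyS : ∀ i, y i ∈ P.S i := zbar_mem hcon (by omega)
  have hyB : y ∈ P.SbarProd εbar := mem_SbarProd_of_mem hyS
  have he0 : 0 ≤ e := (norm_nonneg _).trans he
  have hyz : ‖y - z k‖ ≤ ‖y - x‖ + e := by
    have : y - z k = (y - x) + (x - z k) := by abel
    rw [this]; exact (norm_add_le _ _).trans (by linarith)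
  -- The gradient of the proximal model at its solution; by optimality -ω is normal to the feasible
  -- set at y, so ∇f(y) - ω is a subgradient, and it is small.
  set ω : P.Space := WithLp.toLp 2 fun i =>
    P.gradBlock i (P.mixed z k i) + σ k i • (y i - z k i) with hω
  refine ⟨gradient P.f y - ω, ?_, fun w hw => ?_⟩
  · refine (PiLp.norm_le_sum_norm _).trans ?_
    have h1 : ∀ i, ‖(gradient P.f y - ω) i‖ ≤ 3 * M * (‖y - x‖ + e) := fun i => by
      have h2 : (gradient P.f y - ω) i = (P.gradBlock i y - P.gradBlock i (P.mixed z k i)) -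
          σ k i • (y i - z k i) := by
        rw [PiLp.sub_apply, sub_sub]; rfl
      have h3 : ‖P.gradBlock i y - P.gradBlock i (P.mixed z k i)‖ ≤
          Lip i * (e + (‖y - x‖ + e)) := by
        rw [mixed_eq_hybrid]
        refine ((hLip i).2 _ hyB _ (hybrid_mem_SbarProd hz' hz i)).trans ?_
        have := (hLip i).1
        gcongr
        have h4 := norm_hybrid_sub_hybrid_le y y (z (k + 1)) (z k) i
        rw [hybrid_self] at h4
        linarith
      have h5 : ‖σ k i • (y i - z k i)‖ ≤ σ k i * (‖y - x‖ + e) := by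
        rw [norm_smul, Real.norm_of_nonneg (hσ i).le]
        have := (hσ i).le
        gcongr
        exact (PiLp.norm_apply_le (y - z k) i).trans hyz
      rw [h2]
      refine (norm_sub_le _ _).trans ?_
      have h6 : 0 ≤ ‖y - x‖ := norm_nonneg _
      have h7 := hσL i
      have h8 := hσM i
      have h9 : Lip i * (e + (‖y - x‖ + e)) ≤ M * (e + (‖y - x‖ + e)) := by gcongr; linarith
      have h10 : σ k i * (‖y - x‖ + e) ≤ M * (‖y - x‖ + e) := by gcongr
      have h11 : 0 ≤ M * ‖y - x‖ := mul_nonneg ((hσ i).le.trans h8) h6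
      linarith
    refine (Finset.sum_le_sum fun i _ => h1 i).trans (le_of_eq ?_)
    simp; ring
  · have h1 : gradient P.f y - ω - gradient P.f y = -ω := by abel
    rw [h1, inner_neg_left, PiLp.inner_apply, neg_nonpos]
    exact Finset.sum_nonneg fun i _ => inner_zbar_nonneg hcon (hσ i) (hw i)

end Step

end BlockProblem

/-! ### Asymptotic control of the iterates and assembly. -/

theorem rpow_neg_isBigO_rpow_neg {p q : ℝ} (hpq : p ≤ q) :
    (fun k : ℕ => (k : ℝ) ^ (-q)) =O[atTop] fun k : ℕ => (k : ℝ) ^ (-p) := by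
  refine IsBigO.of_bound 1 ?_
  filter_upwards [eventually_ge_atTop 1] with k hk
  have hk1 : (1 : ℝ) ≤ k := by exact_mod_cast hk
  rw [one_mul, Real.norm_of_nonneg (by positivity), Real.norm_of_nonneg (by positivity)]
  exact Real.rpow_le_rpow_of_exponent_le hk1 (by linarith)

theorem exists_abs_surrogateConst_le {n : ℕ} (L γ : ℝ) {σ : ℕ → Fin n → ℝ} {M : ℝ}
    (hσ : ∀ k i, 0 ≤ σ k i) (hσM : ∀ k i, σ k i ≤ M) :
    ∃ B, ∀ k, |surrogateConst L γ σ k| ≤ B := by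
  set c := L * (12 / (γ - 1) / 2 * (n : ℝ) ^ 2 +
    (2 + 2 / (12 / (γ - 1)) - 12 / (γ - 1) / 2) * (n : ℝ)
    + 2 * (12 / (γ - 1)) + 4 / (12 / (γ - 1)) + 3) with hc
  refine ⟨(max M 0 + |c|) / 2, fun k => ?_⟩
  have h1 : 0 ≤ ⨆ i, σ k i := Real.iSup_nonneg (hσ k)
  have h2 : ⨆ i, σ k i ≤ max M 0 :=
    Real.iSup_le (fun i => (hσM k i).trans (le_max_left _ _)) (le_max_right _ _)
  have h3 : surrogateConst L γ σ k = ((⨆ i, σ k i) + c) / 2 := rfl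
  rw [h3, abs_div, abs_two]
  gcongr
  refine (abs_add_le _ _).trans ?_
  rw [abs_of_nonneg h1]
  gcongr

namespace BlockProblem

variable {n : ℕ} {P : BlockProblem n} {εbar Ml : ℝ} {Lip : Fin n → ℝ}

theorem F_eq_of_mem {w : P.Space} (hw : ∀ i, w i ∈ P.S i) : P.F w = P.f w := by
  have h1 : ∑ i, setIndicator (P.S i) (w i) = 0 :=
    Finset.sum_eq_zero fun i _ => if_pos (hw i)
  rw [F, h1, add_zero]

theorem F_eq_top_of_notMem {w : P.Space} (hw : ¬ ∀ i, w i ∈ P.S i) : P.F w = ⊤ := by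
  push Not at hw
  obtain ⟨i, hi⟩ := hw
  have h0 : ∀ j, 0 ≤ setIndicator (P.S j) (w j) := fun j => by
    unfold setIndicator; split_ifs
    · exact le_rfl
    · exact le_top
  have h1 : ∑ i, setIndicator (P.S i) (w i) = ⊤ := by
    rw [← Finset.add_sum_erase _ _ (Finset.mem_univ i),
      show setIndicator (P.S i) (w i) = ⊤ from if_neg hi]
    refine EReal.top_add_of_ne_bot (ne_of_gt ?_)
    exact lt_of_lt_of_le EReal.bot_lt_zero (Finset.sum_nonneg fun j _ => h0 j)
  rw [F, h1, EReal.coe_add_top]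

theorem isCompact_forall_mem (hcon : P.ConstraintAssumption εbar Ml) :
    IsCompact {w : P.Space | ∀ i, w i ∈ P.S i} := by
  have h1 : {w : P.Space | ∀ i, w i ∈ P.S i} = WithLp.toLp 2 '' (univ.pi P.S) := by
    ext w
    constructor
    · intro hw
      exact ⟨WithLp.ofLp w, fun i _ => hw i, rfl⟩
    · rintro ⟨v, hv, rfl⟩ i
      exact hv i trivial
  rw [h1]
  exact (isCompact_univ_pi hcon.compact).image (PiLp.continuous_toLp 2 _)

section Iterates

variable {Mu : ℝ} {ε : ℕ → ℝ} {σ : ℕ → Fin n → ℝ} {z : ℕ → P.Space}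

/-- Constraint violations are at most ε². Compactness and convexity then give proximity without the
Hoffman bound, which is assumed only near the feasible set. -/
theorem IsIPALM.eventually_mem_SbarProd (hz : P.IsIPALM Ml Mu ε σ z)
    (hcon : P.ConstraintAssumption εbar Ml) (hεbar : 0 < εbar) (hε : Tendsto ε atTop (𝓝 0)) :
    ∀ᶠ k in atTop, z (k + 1) ∈ P.SbarProd εbar := by
  refine eventually_all.2 fun i => ?_
  obtain ⟨δ, hδ, h⟩ := exists_forall_le_imp_mem_cthickening (h := P.h i) (P.convexOn_h i)
    (fun j => (P.differentiable_h i j).continuous) (S := P.S i) rfl (hcon.nonempty i)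
    (hcon.compact i) hεbar
  have hε2 : Tendsto (fun k => ε k ^ 2) atTop (𝓝 0) := by simpa using hε.pow 2
  filter_upwards [hε2.eventually (ge_mem_nhds hδ)] with k hk
  refine h _ fun j => ?_
  obtain ⟨lam, -, hres⟩ := hz.inexact k i
  have h1 := P.max_constraint_le_residual i (z (k + 1) i) lam (P.gradStep z σ k i)
  have h2 := norm_le_pi_norm (fun j => max (P.h i (z (k + 1) i) j) 0) j
  have h3 : P.h i (z (k + 1) i) j ≤ ‖max (P.h i (z (k + 1) i) j) 0‖ :=
    (le_max_left _ _).trans (le_abs_self _)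
  exact h3.trans (h2.trans (h1.trans ((Real.sqrt_le_iff.1 hres).2.trans hk)))

/-- On the bounded thickened sets all points involved lie in a fixed ball, so the residual estimate
has a uniform constant. It bounds a squared distance by a multiple of ε², hence the linear
dependence on ε. -/
theorem IsIPALM.exists_norm_zbar_sub_le (hz : P.IsIPALM Ml Mu ε σ z)
    (hLip : P.BlockLipschitz εbar Lip) (hcon : P.ConstraintAssumption εbar Ml)
    {μ : ℝ} (hμ : 0 < μ) (hσμ : ∀ k i, μ ≤ σ k i)
    (hε0 : ∀ k, 0 ≤ ε k) :
    ∃ C, 0 < C ∧ ∀ k, z k ∈ P.SbarProd εbar → z (k + 1) ∈ P.SbarProd εbar →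
      ‖P.zbar z σ (k + 1) - z (k + 1)‖ ≤ C * ε k := by
  have hR : ∀ i, ∃ R, 0 < R ∧ ∀ x ∈ P.Sbar εbar i, ‖x‖ ≤ R := fun i =>
    ((hcon.compact i).isBounded.cthickening).exists_pos_norm_le
  choose R hR0 hR using hR
  choose w hw using hcon.nonempty
  set w' : P.Space := WithLp.toLp 2 w with hw'
  have hw'B : w' ∈ P.SbarProd εbar := mem_SbarProd_of_mem hw
  set Γ : Fin n → ℝ := fun i => ‖P.gradBlock i w'‖ + Lip i * (∑ j, R j + ‖w'‖) with hΓ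
  have hgrad : ∀ i, ∀ v ∈ P.SbarProd εbar, ‖P.gradBlock i v‖ ≤ Γ i := fun i v hv => by
    have h1 := (hLip i).2 v hv w' hw'B
    have h2 : ‖v‖ ≤ ∑ j, R j :=
      (PiLp.norm_le_sum_norm v).trans (Finset.sum_le_sum fun j _ => hR j _ (hv j))
    have h3 := mul_le_mul_of_nonneg_left ((norm_sub_le v w').trans (add_le_add_left h2 ‖w'‖))
      (hLip i).1.le
    have h4 := norm_le_norm_add_norm_sub' (P.gradBlock i v) (P.gradBlock i w')
    simp only [hΓ]
    linarith
  have hΓ0 : ∀ i, 0 ≤ Γ i := fun i => (norm_nonneg _).trans (hgrad i w' hw'B)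
  have hblock : ∀ i, ∃ K, 0 ≤ K ∧ ∀ k, z k ∈ P.SbarProd εbar → z (k + 1) ∈ P.SbarProd εbar →
      ‖P.zbar z σ (k + 1) i - z (k + 1) i‖ ≤ K * ε k := fun i => by
    obtain ⟨c, hc, hhoff⟩ := hcon.hoffman i
    set T := R i + Γ i / μ with hT
    have hT0 : 0 ≤ T := add_nonneg (hR0 i).le (div_nonneg (hΓ0 i) hμ.le)
    have hRT : R i ≤ T := le_add_of_nonneg_right (div_nonneg (hΓ0 i) hμ.le)
    set K := 4 * T * c * P.p i + 2 * P.m i * T + 4 with hK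
    have hK0 : 0 ≤ K := by positivity
    refine ⟨Real.sqrt K, Real.sqrt_nonneg _, fun k hzk hzk1 => ?_⟩
    obtain ⟨lam, hlam, hres⟩ := hz.inexact k i
    have hε0k := hε0 k
    replace hres := (Real.sqrt_le_iff.1 hres).2
    have hσ0 : 0 < σ k i := hμ.trans_le (hσμ k i)
    have hmem := (P.exactBlock_spec z σ k i (hcon.nonempty i) (hcon.compact i)).1
    have hxt : ‖P.gradStep z σ k i‖ ≤ T := by
      refine (norm_sub_le _ _).trans (add_le_add (hR i _ (hzk i)) ?_)
      rw [norm_smul, Real.norm_of_nonneg (by positivity), one_div_mul_eq_div]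
      exact div_le_div₀ (hΓ0 i) (hgrad i _ (hybrid_mem_SbarProd hzk1 hzk i)) hμ (hσμ k i)
    have h1 := P.sq_norm_sub_le_residual hlam (hcon.nonempty i) (hcon.compact i) hmem
      (fun y hy => norm_exactBlock_sub_le (hcon.nonempty i) (hcon.compact i) hσ0 hy) hT0 hc
      ((hR i _ (hzk1 i)).trans hRT)
      ((hR i _ (Metric.self_subset_cthickening _ hmem)).trans hRT) hxt
      (hhoff _ (Metric.self_subset_cthickening _ (hzk1 i)))
    refine le_of_sq_le_sq ?_ (by positivity)
    rw [mul_pow, Real.sq_sqrt hK0]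
    exact h1.trans (mul_le_mul_of_nonneg_left hres hK0)
  choose K hK0 hK using hblock
  have hKs : 0 ≤ ∑ i, K i := Finset.sum_nonneg fun i _ => hK0 i
  refine ⟨∑ i, K i + 1, by linarith, fun k hzk hzk1 => ?_⟩
  refine (PiLp.norm_le_sum_norm _).trans ?_
  have h1 : ∑ i, ‖(P.zbar z σ (k + 1) - z (k + 1)) i‖ ≤ ∑ i, K i * ε k :=
    Finset.sum_le_sum fun i _ => hK i k hzk hzk1
  refine h1.trans ?_
  rw [← Finset.sum_mul]
  have := hε0 k
  gcongr
  linarith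

end Iterates

end BlockProblem

theorem mainTheorem3 {n : ℕ} (P : BlockProblem n)
    (εbar γ L Mu ℓ : ℝ) (Lip : Fin n → ℝ)
    (hεbar : 0 < εbar) (hγ : 1 < γ) (hℓ : 1 < ℓ)
    (hL : L = ⨆ i, Lip i) (hMu : γ * L ≤ Mu)
    (hLip : P.BlockLipschitz εbar Lip)
    (hcon : P.ConstraintAssumption εbar (γ * L))
    (hKL : P.LojasiewiczAssumption)
    (σ : ℕ → Fin n → ℝ) (z : ℕ → P.Space)
    (hz : P.IsIPALM (γ * L) Mu (fun k => εbar / ((k : ℝ) + 1) ^ ℓ) σ z) :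
    Summable (P.errTerm L γ σ z) ∧
    ∃ Flim : ℝ, Tendsto (P.surrogate L γ σ z) atTop (𝓝 (Flim : EReal)) ∧
    ∃ zlim : P.Space, Tendsto z atTop (𝓝 zlim) ∧ IsStationaryPt P.F zlim ∧
      ((∀ k : ℕ, 1 ≤ k → (Flim : EReal) < P.surrogate L γ σ z k) →
        ∀ θ : ℝ, IsLojasiewiczExponent P.F zlim θ →
          ((1 / 2 < θ ∧ θ / (2 * θ - 1) ≤ ℓ) →
            (fun k : ℕ => ‖z k - zlim‖) =O[atTop]
              fun k : ℕ => (k : ℝ) ^ (-((1 - θ) / (2 * θ - 1)))) ∧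
          (¬ (1 / 2 < θ ∧ θ / (2 * θ - 1) ≤ ℓ) →
            (fun k : ℕ => ‖z k - zlim‖) =O[atTop]
              fun k : ℕ => (k : ℝ) ^ (-(ℓ - 1)))) := by
  obtain ⟨μ, hμ, hσμ⟩ : ∃ μ > 0, ∀ k i, μ ≤ σ k i := by
    -- With no blocks the supremum L is 0 and γ L gives no positive lower bound, so an arbitrary one
    -- is taken.
    rcases Nat.eq_zero_or_pos n with rfl | hn
    · exact ⟨1, one_pos, fun k i => i.elim0⟩
    · have hL0 : 0 < L := by
        rw [hL]
        exact (hLip ⟨0, hn⟩).1.trans_le (le_ciSup (Finite.bddAbove_range Lip) _)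
      exact ⟨γ * L, by positivity, fun k i => (hz.sigma_mem k i).1⟩
  have hσ0 : ∀ k i, 0 < σ k i := fun k i => hμ.trans_le (hσμ k i)
  have hσL : ∀ k i, Lip i ≤ σ k i := fun k i => by
    have h1 : Lip i ≤ L := hL ▸ le_ciSup (Finite.bddAbove_range Lip) i
    have h2 := (hz.sigma_mem k i).1
    have h3 := (hLip i).1
    nlinarith
  have hσM : ∀ k i, σ k i ≤ Mu := fun k i => (hz.sigma_mem k i).2
  have hℓ0 : 0 < ℓ := by linarith
  have hε_eq : ∀ k : ℕ, εbar / ((k : ℝ) + 1) ^ ℓ = εbar * ((k + 1 : ℕ) : ℝ) ^ (-ℓ) := fun k => by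
    rw [Real.rpow_neg (by positivity), div_eq_mul_inv]; push_cast; rfl
  have hε : Tendsto (fun k : ℕ => εbar / ((k : ℝ) + 1) ^ ℓ) atTop (𝓝 0) := by
    simp only [hε_eq]
    simpa using ((tendsto_add_atTop_iff_nat 1).2 (tendsto_nat_rpow_neg hℓ0)).const_mul εbar
  obtain ⟨C₀, hC₀, herr⟩ := hz.exists_norm_zbar_sub_le hLip hcon hμ hσμ
    (fun k => by positivity)
  obtain ⟨N₀, hN₀⟩ := eventually_atTop.1 (hz.eventually_mem_SbarProd hcon hεbar hε)
  set C := C₀ * εbar with hC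
  have hC0 : 0 < C := by positivity
  -- Comparing `zbar k` with `z k` needs both `z (k - 1)` and `z k` in the thickened product; the
  -- tolerance of step k - 1 is exactly εbar k^(-ℓ).
  set N := N₀ + 2 with hN
  have hzB : ∀ k ≥ N, z k ∈ P.SbarProd εbar := fun k hk => by
    obtain ⟨l, rfl⟩ : ∃ l, k = l + 1 := ⟨k - 1, by omega⟩
    exact hN₀ l (by omega)
  have hdist : ∀ k ≥ N, ‖P.zbar z σ k - z k‖ ≤ C * (k : ℝ) ^ (-ℓ) := fun k hk => by
    obtain ⟨l, rfl⟩ : ∃ l, k = l + 1 + 1 := ⟨k - 2, by omega⟩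
    have h1 := herr (l + 1) (hN₀ l (by omega)) (hN₀ (l + 1) (by omega))
    rwa [hε_eq, ← mul_assoc] at h1
  have hdist' : ∀ k ≥ N, ‖P.zbar z σ (k + 1) - z (k + 1)‖ ≤ C * (k : ℝ) ^ (-ℓ) := fun k hk => by
    refine (hdist (k + 1) (by omega)).trans ?_
    have hk0 : (0 : ℝ) < k := by exact_mod_cast (by omega : 0 < k)
    exact mul_le_mul_of_nonneg_left
      (Real.rpow_le_rpow_of_nonpos hk0 (by push_cast; linarith) (by linarith)) hC0.le
  have hdistO : (fun k => ‖P.zbar z σ k - z k‖) =O[atTop] fun k : ℕ => (k : ℝ) ^ (-ℓ) := by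
    refine IsBigO.of_bound C ?_
    filter_upwards [eventually_ge_atTop N] with k hk
    rw [norm_norm, Real.norm_of_nonneg (by positivity)]
    exact hdist k hk
  have hsum : Summable (P.errTerm L γ σ z) := by
    obtain ⟨B, hB⟩ := exists_abs_surrogateConst_le L γ (fun k i => (hσ0 k i).le) hσM
    have h1 : (fun k => surrogateConst L γ σ k) =O[atTop] fun _ : ℕ => (1 : ℝ) :=
      IsBigO.of_bound B (Eventually.of_forall fun k => by simpa using hB k)
    have h2 := h1.mul (hdistO.pow 2)
    refine summable_of_isBigO_nat ?_ h2
    refine (Real.summable_nat_rpow (p := -(2 * ℓ)).2 (by linarith)).congr fun k => ?_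
    rw [one_mul, ← Real.rpow_natCast, ← Real.rpow_mul k.cast_nonneg]
    congr 1; push_cast; ring
  refine ⟨hsum, ?_⟩
  obtain ⟨x, hxS, hx, hstat, hrate⟩ := tendsto_and_isBigO_of_lojasiewicz
    (G := P.F) (f := P.f) (S := {w : P.Space | ∀ i, w i ∈ P.S i}) (y := P.zbar z σ) (N := N)
    (a := μ / 4) (b := n * (9 * Mu ^ 2 / μ) * C ^ 2)
    (C := |(n : ℝ) * (3 * Mu)| * (1 + C) + 1) (ℓ := ℓ)
    (BlockProblem.isCompact_forall_mem hcon) (fun w hw => BlockProblem.F_eq_of_mem hw) (fun w hw => BlockProblem.F_eq_top_of_notMem hw)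
    P.differentiable_f
    (fun w hw => by
      have hlip : LipschitzOnWith (Real.toNNReal (∑ i, Lip i)) (gradient P.f)
          (P.SbarProd εbar) := by
        refine LipschitzOnWith.of_dist_le_mul fun a ha b hb => ?_
        rw [dist_eq_norm, dist_eq_norm,
          Real.coe_toNNReal _ (Finset.sum_nonneg fun i _ => (hLip i).1.le)]
        exact hLip.norm_gradient_sub_le ha hb
      exact (hlip.continuousOn.mono fun v hv => BlockProblem.mem_SbarProd_of_mem hv) w hw)
    hKL (by positivity) (by positivity) (by positivity) hℓ
    (fun k hk => BlockProblem.zbar_mem hcon (by omega))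
    (fun k hk => by
      refine (BlockProblem.f_zbar_succ_le hLip hcon hμ (hσμ k) (hσL k) (hσM k) (by omega) (hzB k hk)
        (hzB (k + 1) (by omega)) (hdist k hk) (hdist' k hk)).trans (le_of_eq ?_)
      ring)
    (fun k hk => by
      obtain ⟨ξ, hξ, hn⟩ := BlockProblem.exists_norm_le_and_normal hLip hcon (hσ0 k) (hσL k) (hσM k) (hzB k hk)
        (hzB (k + 1) (by omega)) (hdist k hk) (hdist' k hk)
      refine ⟨ξ, hξ.trans ?_, hn⟩
      set d := ‖P.zbar z σ (k + 1) - P.zbar z σ k‖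
      have hd : 0 ≤ d := norm_nonneg _
      have ht : 0 ≤ (k : ℝ) ^ (-ℓ) := by positivity
      set t := (k : ℝ) ^ (-ℓ)
      set A := |(n : ℝ) * (3 * Mu)| with hA
      have hA0 : 0 ≤ A := abs_nonneg _
      calc _ ≤ A * (d + C * t) := mul_le_mul_of_nonneg_right (le_abs_self _) (by positivity)
        _ ≤ (A * (1 + C) + 1) * (d + t) := by
          have : (A * (1 + C) + 1) * (d + t) = A * (d + C * t) + (A * C * d + A * t + d + t) := by
            ring
          have : 0 ≤ A * C * d + A * t + d + t := by positivity
          linarith)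
  have hz_sub : Tendsto (fun k => P.zbar z σ k - z k) atTop (𝓝 0) :=
    tendsto_zero_iff_norm_tendsto_zero.2 (hdistO.trans_tendsto (tendsto_nat_rpow_neg hℓ0))
  have hzx : Tendsto z atTop (𝓝 x) := by simpa using hx.sub hz_sub
  refine ⟨P.f x, ?_, x, hzx, hstat, fun _ θ hθ => ?_⟩
  · have htail : Tendsto (fun k => P.errTail L γ σ z k) atTop (𝓝 0) := tendsto_sum_nat_add _
    have h1 : Tendsto (fun k => P.f (P.zbar z σ k) +
        (P.errTail L γ σ z k + P.errTail L γ σ z (k + 1))) atTop (𝓝 (P.f x)) := by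
      simpa using ((P.differentiable_f.continuous.tendsto x).comp hx).add
        (htail.add ((tendsto_add_atTop_iff_nat 1).2 htail))
    refine ((continuous_coe_real_ereal.tendsto _).comp h1).congr' ?_
    filter_upwards [eventually_ge_atTop 1] with k hk
    rw [BlockProblem.surrogate, BlockProblem.F_eq_of_mem (BlockProblem.zbar_mem hcon hk), Function.comp_apply, EReal.coe_add]
  -- Rates pass from `zbar` to `z` as long as they are no faster than the k^(-ℓ) gap between the two
  -- sequences.
  have hzrate : ∀ {q : ℝ}, q ≤ ℓ →
      ((fun k => ‖P.zbar z σ k - x‖) =O[atTop] fun k : ℕ => (k : ℝ) ^ (-q)) →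
      (fun k => ‖z k - x‖) =O[atTop] fun k : ℕ => (k : ℝ) ^ (-q) := by
    intro q hq h
    have h1 := h.of_norm_left.sub
      (hdistO.trans (rpow_neg_isBigO_rpow_neg hq)).of_norm_left
    refine (h1.congr_left fun k => ?_).norm_left
    abel
  have hq : 0 < 2 * ℓ - 1 := by linarith
  refine ⟨fun ⟨hθ1, hθℓ⟩ => ?_, fun hnot => ?_⟩
  · have h2θ : 0 < 2 * θ - 1 := by linarith
    rw [div_le_iff₀ h2θ] at hθℓ
    refine hzrate ?_ (hrate θ hθ θ le_rfl ?_ hθ.2.1)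
    · rw [div_le_iff₀ h2θ]; linarith
    · rw [div_le_iff₀ hq]; linarith
  -- For θ > 1/2 the condition θ/(2θ-1) ≤ ℓ is equivalent to ℓ/(2ℓ-1) ≤ θ; when it fails, the
  -- exponent is raised to ℓ/(2ℓ-1).
  · have hθ₀ : θ ≤ ℓ / (2 * ℓ - 1) := by
      rw [le_div_iff₀ hq]
      by_contra! hlt
      have h1 : 1 / 2 < θ := by nlinarith
      exact hnot ⟨h1, by rw [div_le_iff₀ (by linarith)]; linarith⟩
    have h1 := hrate θ hθ _ hθ₀ le_rfl (by rw [div_lt_one hq]; linarith)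
    have h2 : (1 - ℓ / (2 * ℓ - 1)) / (2 * (ℓ / (2 * ℓ - 1)) - 1) = ℓ - 1 := by
      have e1 : 2 * (ℓ / (2 * ℓ - 1)) - 1 = 1 / (2 * ℓ - 1) := by
        rw [eq_div_iff hq.ne', sub_mul, mul_assoc, div_mul_cancel₀ _ hq.ne']; ring
      have e2 : 1 - ℓ / (2 * ℓ - 1) = (ℓ - 1) / (2 * ℓ - 1) := by
        rw [eq_div_iff hq.ne', sub_mul, div_mul_cancel₀ _ hq.ne']; ring
      rw [e1, e2, div_div_div_cancel_right₀ hq.ne', div_one]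
    rw [h2] at h1
    exact hzrate (by linarith) h1
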